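/- Let $M$ be a smooth ($C^\infty$) $n$-manifold without boundary (Hausdorff, second countable), only finitely many of whose connected components are compact (for instance, any connected $M$). Charts $\alpha$ are taken from the maximal smooth atlas $\mathcal A(M)$, with open domain $\operatorname{dom}\alpha\subset M$ and open range $\operatorname{ran}\alpha\subset\mathbb R^n$; $\partial$ denotes topological boundary and $\partial_U$ the boundary relative to $U$. *Extensions.* A point $p\in\partial\operatorname{ran}\alpha$ is an admissible boundary point of $\alpha$, $p\in \mathrm{BP}(\alpha)$, if no sequence $(x_i)\subset\operatorname{dom}\alpha$ with $\alpha(x_i)\to p$ has an accumulation point in $M$. An extension of $\alpha$ is an open set $U\subset\mathbb R^n$ with $\operatorname{ran}\alpha\subset U$ and $\varnothing\ne\partial_U\operatorname{ran}\alpha\subset \mathrm{BP}(\alpha)$. If $\alpha$ has an extension, it has a largest one, $U_\alpha$ (the union of all its extensions). Let $Q_{\mathcal A}=\{(\alpha,U_\alpha):\alpha\in\mathcal A(M)\text{ has an extension}\}$. *Equivalence.* For extensions $U$ of $\alpha$ and $X$ of $\beta$, and points $x\in\partial_U\operatorname{ran}\alpha$, $y\in\partial_X\operatorname{ran}\beta$,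 say that $(\alpha,U,\{x\})$ covers $(\beta,X,\{y\})$ if every sequence $(y_i)\subset\operatorname{dom}\beta$ such that $(\beta(y_i))$ has $y$ as an accumulation point has a subsequence $(v_i)\subset\operatorname{dom}\alpha$ such that $(\alpha(v_i))$ has $x$ as an accumulation point. Write $(\alpha,U,\{x\})\equiv(\beta,X,\{y\})$ if each covers the other. *Completion.* Let $S=\{(\alpha,\operatorname{ran}\alpha):\alpha\in\mathcal A(M)\}\cup Q_{\mathcal A}$ and, for $(\alpha,U)\in S$, let $N_{(\alpha,U)}=\operatorname{ran}\alpha\cup\partial_U\operatorname{ran}\alpha$ with the subspace topology from $\mathbb R^n$. The completion $Q_{\mathcal A}(M)$ is the quotient space of the disjoint union $\bigsqcup_{(\alpha,U)\in S}N_{(\alpha,U)}$ by the equivalence relation identifying $x\in N_{(\alpha,U)}$ with $y\in N_{(\beta,X)}$ if and only if either $x\in\operatorname{ran}\alpha$, $y\in\operatorname{ran}\beta$ and $\beta\circ\alpha^{-1}(x)=y$ (in particular, $\alpha^{-1}(x)\in\operatorname{dom}\beta$), or $x\in\partial_U\operatorname{ran}\alpha$, $y\in\partial_X\operatorname{ran}\beta$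 and $(\alpha,U,\{x\})\equiv(\beta,X,\{y\})$. The map $\imath:M\to Q_{\mathcal A}(M)$ is $\imath(x)=[\alpha(x)]$ for any chart $\alpha\in\mathcal A(M)$ with $x\in\operatorname{dom}\alpha$. **Proposition.** For every sequence $(x_i)$ in $M$, the sequence $(\imath(x_i))$ has at least one limit point (accumulation point) in $Q_{\mathcal A}(M)$; that is, there is a point every neighbourhood of which contains $\imath(x_i)$ for infinitely many indices $i$. -/

import Mathlib

open Filter Topology
open scoped Manifold ContDiff

namespace ChartBoundary

variable {n : ℕ} {M : Type*} [TopologicalSpace M]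

/-- Coordinate charts are open partial homeomorphisms into Euclidean space: `α.source` is the
domain of `α` and `α.target` is its range. -/
abbrev Chart (n : ℕ) (M : Type*) [TopologicalSpace M] :=
  OpenPartialHomeomorph M (EuclideanSpace ℝ (Fin n))

/-- The topological boundary of `A` relative to `U`, i.e. the boundary of `A ∩ U` in the
subspace `U`, regarded as a subset of the ambient space. -/
def relBoundary {X : Type*} [TopologicalSpace X] (U A : Set X) : Set X :=
  (Subtype.val : U → X) '' frontier ((Subtype.val : U → X) ⁻¹' A)

theorem relBoundary_eq {X : Type*} [TopologicalSpace X] {U : Set X} (hU : IsOpen U)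
    (A : Set X) : relBoundary U A = U ∩ frontier A := by
  unfold relBoundary
  rw [← hU.isOpenMap_subtype_val.preimage_frontier_eq_frontier_preimage continuous_subtype_val,
    Subtype.image_preimage_coe]

/-- The admissible boundary points of a chart `α`: the boundary points `p` of its range such
that no sequence in the domain whose coordinates converge to `p` has an accumulation point
in `M`. -/
def admissibleBoundary (α : Chart n M) : Set (EuclideanSpace ℝ (Fin n)) :=
  {p | p ∈ frontier α.target ∧ ∀ x : ℕ → M, (∀ i, x i ∈ α.source) →
    Tendsto (fun i => α (x i)) atTop (𝓝 p) → ∀ m : M, ¬ MapClusterPt m atTop x}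

/-- `U` is an extension of the chart `α`. -/
structure IsExtension (α : Chart n M) (U : Set (EuclideanSpace ℝ (Fin n))) : Prop where
  isOpen : IsOpen U
  range_subset : α.target ⊆ U
  nonempty : (relBoundary U α.target).Nonempty
  subset_admissible : relBoundary U α.target ⊆ admissibleBoundary α

/-- A chart is extendible if it has an extension. -/
def Extendible (α : Chart n M) : Prop := ∃ U, IsExtension α U

/-- The maximal extension of an extendible chart: the union of all its extensions. -/
def maxExtension (α : Chart n M) : Set (EuclideanSpace ℝ (Fin n)) :=
  ⋃₀ {U | IsExtension α U}

theorem isGreatest_maxExtension {α : Chart n M} (h : Extendible α) :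
    IsGreatest {U | IsExtension α U} (maxExtension α) := by
  have ho : IsOpen (maxExtension α) := isOpen_sUnion fun U hU => hU.isOpen
  refine ⟨⟨ho, ?_, ?_, ?_⟩, fun U hU => Set.subset_sUnion_of_mem hU⟩
  · obtain ⟨U, hU⟩ := h
    exact hU.range_subset.trans (Set.subset_sUnion_of_mem hU)
  · obtain ⟨U, hU⟩ := h
    obtain ⟨p, hp⟩ := hU.nonempty
    rw [relBoundary_eq hU.isOpen] at hp
    refine ⟨p, ?_⟩
    rw [relBoundary_eq ho]
    exact ⟨Set.subset_sUnion_of_mem (show U ∈ {U | IsExtension α U} from hU) hp.1, hp.2⟩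
  · rw [relBoundary_eq ho]
    rintro p ⟨⟨U, hU, hpU⟩, hp⟩
    apply hU.subset_admissible
    rw [relBoundary_eq hU.isOpen]
    exact ⟨hpU, hp⟩

/-- The boundary set `V` of the chart `α` covers the boundary set `Y` of the chart `β`: every
sequence in the domain of `β` whose `β`-coordinates accumulate at a point of `Y` has a
subsequence in the domain of `α` whose `α`-coordinates accumulate at a point of `V`. -/
def Covers (α : Chart n M) (V : Set (EuclideanSpace ℝ (Fin n)))
    (β : Chart n M) (Y : Set (EuclideanSpace ℝ (Fin n))) : Prop :=
  ∀ y : ℕ → M, (∀ i, y i ∈ β.source) →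
    (∃ p ∈ Y, MapClusterPt p atTop (fun i => β (y i))) →
    ∃ k : ℕ → ℕ, StrictMono k ∧ (∀ i, y (k i) ∈ α.source) ∧
      ∃ p ∈ V, MapClusterPt p atTop (fun i => α (y (k i)))

/-- Equivalence of boundary sets: each covers the other. -/
def BdEquiv (α : Chart n M) (V : Set (EuclideanSpace ℝ (Fin n)))
    (β : Chart n M) (Y : Set (EuclideanSpace ℝ (Fin n))) : Prop :=
  Covers α V β Y ∧ Covers β Y α V

theorem Covers.refl (α : Chart n M) (V : Set (EuclideanSpace ℝ (Fin n))) : Covers α V α V :=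
  fun _ hy hp => ⟨id, strictMono_id, hy, hp⟩

theorem Covers.trans {α β γ : Chart n M} {V Y Z : Set (EuclideanSpace ℝ (Fin n))}
    (h₁ : Covers α V β Y) (h₂ : Covers β Y γ Z) : Covers α V γ Z := by
  intro z hz hp
  obtain ⟨k, hk, hks, hkp⟩ := h₂ z hz hp
  obtain ⟨l, hl, hls, hlp⟩ := h₁ (fun i => z (k i)) hks hkp
  exact ⟨fun i => k (l i), hk.comp hl, hls, hlp⟩

theorem disjoint_target_relBoundary (α : Chart n M) (U : Set (EuclideanSpace ℝ (Fin n)))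
    {p : EuclideanSpace ℝ (Fin n)} (hp : p ∈ α.target) : p ∉ relBoundary U α.target := by
  rintro ⟨q, hq, rfl⟩
  rw [(α.open_target.preimage continuous_subtype_val).frontier_eq] at hq
  exact hq.2 hp

section Manifold

variable [ChartedSpace (EuclideanSpace ℝ (Fin n)) M]

/-- The pairs `(α, range α)`, for `α` in the maximal smooth atlas of `M`. -/
def trivialPairs (n : ℕ) (M : Type*) [TopologicalSpace M]
    [ChartedSpace (EuclideanSpace ℝ (Fin n)) M] :
    Set (Chart n M × Set (EuclideanSpace ℝ (Fin n))) :=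
  {s | s.1 ∈ IsManifold.maximalAtlas (𝓡 n) ∞ M ∧ s.2 = s.1.target}

/-- The pairs indexing the pieces from which the completion with respect to `Q` is glued. -/
def indexPairs (Q : Set (Chart n M × Set (EuclideanSpace ℝ (Fin n)))) :
    Set (Chart n M × Set (EuclideanSpace ℝ (Fin n))) :=
  trivialPairs n M ∪ Q

/-- The piece given by a pair `(α, U)`: the range of `α` with its boundary relative to `U`. -/
def piece (s : Chart n M × Set (EuclideanSpace ℝ (Fin n))) : Set (EuclideanSpace ℝ (Fin n)) :=
  s.1.target ∪ relBoundary s.2 s.1.target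

/-- The disjoint union of all the pieces, with the disjoint union topology (each piece has the
topology of a subspace of Euclidean space). -/
abbrev Pieces (Q : Set (Chart n M × Set (EuclideanSpace ℝ (Fin n)))) :=
  Σ s : indexPairs Q, piece s.1

/-- The gluing relation between a point `x` of the piece of `(α, U)` and a point `y` of the
piece of `(β, X)`: either both lie in the ranges of the charts and the coordinate change takes
`x` to `y`, or both are boundary points and `(α, U, {x})` and `(β, X, {y})` are equivalent. -/
def Glued {Q : Set (Chart n M × Set (EuclideanSpace ℝ (Fin n)))} (a b : Pieces Q) : Prop :=
  ((a.2 : EuclideanSpace ℝ (Fin n)) ∈ a.1.1.1.target ∧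
    (b.2 : EuclideanSpace ℝ (Fin n)) ∈ b.1.1.1.target ∧
    a.1.1.1.symm a.2 ∈ b.1.1.1.source ∧ b.1.1.1 (a.1.1.1.symm a.2) = b.2) ∨
  ((a.2 : EuclideanSpace ℝ (Fin n)) ∈ relBoundary a.1.1.2 a.1.1.1.target ∧
    (b.2 : EuclideanSpace ℝ (Fin n)) ∈ relBoundary b.1.1.2 b.1.1.1.target ∧
    BdEquiv a.1.1.1 {(a.2 : EuclideanSpace ℝ (Fin n))}
      b.1.1.1 {(b.2 : EuclideanSpace ℝ (Fin n))})

theorem glued_equivalence (Q : Set (Chart n M × Set (EuclideanSpace ℝ (Fin n)))) :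
    Equivalence (Glued (Q := Q)) where
  refl a := by
    rcases a.2.2 with h | h
    · exact Or.inl ⟨h, h, a.1.1.1.map_target h, a.1.1.1.right_inv h⟩
    · exact Or.inr ⟨h, h, Covers.refl _ _, Covers.refl _ _⟩
  symm := by
    rintro a b (⟨ha, hb, hs, he⟩ | ⟨ha, hb, h₁, h₂⟩)
    · have key : b.1.1.1.symm b.2 = a.1.1.1.symm a.2 := by
        rw [← he, b.1.1.1.left_inv hs]
      refine Or.inl ⟨hb, ha, ?_, ?_⟩
      · rw [key]; exact a.1.1.1.map_target ha
      · rw [key]; exact a.1.1.1.right_inv ha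
    · exact Or.inr ⟨hb, ha, h₂, h₁⟩
  trans := by
    rintro a b c (⟨ha, hb, hs, he⟩ | ⟨ha, hb, h₁, h₂⟩) (⟨hb', hc, hs', he'⟩ | ⟨hb', hc, h₃, h₄⟩)
    · have key : b.1.1.1.symm b.2 = a.1.1.1.symm a.2 := by
        rw [← he, b.1.1.1.left_inv hs]
      rw [key] at hs' he'
      exact Or.inl ⟨ha, hc, hs', he'⟩
    · exact absurd hb' (disjoint_target_relBoundary _ _ hb)
    · exact absurd hb (disjoint_target_relBoundary _ _ hb')
    · exact Or.inr ⟨ha, hc, h₁.trans h₃, h₄.trans h₂⟩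

/-- The gluing relation as a setoid. -/
def gluing (Q : Set (Chart n M × Set (EuclideanSpace ℝ (Fin n)))) : Setoid (Pieces Q) :=
  ⟨Glued, glued_equivalence Q⟩

/-- The completion of `M` with respect to a set `Q` of extensions: the disjoint union of the
pieces modulo the gluing relation. -/
def Completion (Q : Set (Chart n M × Set (EuclideanSpace ℝ (Fin n)))) := Quotient (gluing Q)

/-- The completion carries the quotient topology. -/
instance (Q : Set (Chart n M × Set (EuclideanSpace ℝ (Fin n)))) :
    TopologicalSpace (Completion Q) :=
  inferInstanceAs (TopologicalSpace (Quotient (gluing Q)))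

/-- The quotient map onto the completion. -/
def toCompletion (Q : Set (Chart n M × Set (EuclideanSpace ℝ (Fin n)))) (a : Pieces Q) :
    Completion Q :=
  Quotient.mk (gluing Q) a

/-- The point with coordinates `α x` in the piece `range α` of a chart `α` of the atlas. -/
def coordPoint (Q : Set (Chart n M × Set (EuclideanSpace ℝ (Fin n)))) (α : Chart n M)
    (hα : α ∈ IsManifold.maximalAtlas (𝓡 n) ∞ M) (x : M) (hx : x ∈ α.source) : Pieces Q :=
  ⟨⟨(α, α.target), Or.inl ⟨hα, rfl⟩⟩, ⟨α x, Or.inl (α.map_source hx)⟩⟩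

/-- The canonical map from `M` to its completion, `x ↦ [α x]`. By `toCompletion_coordPoint` any
chart `α` around `x` may be used. -/
def incl [IsManifold (𝓡 n) ∞ M] (Q : Set (Chart n M × Set (EuclideanSpace ℝ (Fin n)))) (x : M) :
    Completion Q :=
  toCompletion Q (coordPoint Q (chartAt (EuclideanSpace ℝ (Fin n)) x)
    (IsManifold.chart_mem_maximalAtlas x) x (mem_chart_source _ x))

theorem toCompletion_coordPoint [IsManifold (𝓡 n) ∞ M]
    (Q : Set (Chart n M × Set (EuclideanSpace ℝ (Fin n)))) (α : Chart n M)
    (hα : α ∈ IsManifold.maximalAtlas (𝓡 n) ∞ M) (x : M) (hx : x ∈ α.source) :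
    toCompletion Q (coordPoint Q α hα x hx) = incl Q x := by
  apply Quotient.sound
  refine Or.inl ⟨α.map_source hx, (chartAt _ x).map_source (mem_chart_source _ x), ?_, ?_⟩
  · change α.symm (α x) ∈ (chartAt (EuclideanSpace ℝ (Fin n)) x).source
    rw [α.left_inv hx]
    exact mem_chart_source _ x
  · change chartAt (EuclideanSpace ℝ (Fin n)) x (α.symm (α x)) = _
    rw [α.left_inv hx]
    rfl

/-- The set of all maximal extensions of extendible charts of the maximal smooth atlas. -/
def maxExtensions (n : ℕ) (M : Type*) [TopologicalSpace M]
    [ChartedSpace (EuclideanSpace ℝ (Fin n)) M] :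
    Set (Chart n M × Set (EuclideanSpace ℝ (Fin n))) :=
  {s | s.1 ∈ IsManifold.maximalAtlas (𝓡 n) ∞ M ∧ Extendible s.1 ∧ s.2 = maxExtension s.1}

end Manifold

end ChartBoundary

/-! If the sequence accumulates in `M`, continuity of `incl` suffices. Otherwise it leaves every
compact set, and it is enough to build one chart `α` and one open set `U` such that the coordinates
of infinitely many terms accumulate at a point of `U` outside `α.target`, while every point of `U`
outside `α.target` escapes (`EscapesAt`). Then `U ∪ α.target` is an extension
(`exists_mapClusterPt_of_escapesAt`).

If one component is visited infinitely often, a point `y` of it is pushed to infinity along the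
sequence. A limit of diffeomorphisms gives an open embedding `f : M → M` that sends infinitely many
terms into a compact neighbourhood of `y` (`exists_isSelfEmbedding_notMem_range`). Their images
accumulate at some `z`, and `z` is not in the range of `f` because the terms diverge. For a chart
`e` at `z`, the chart `e ∘ f` has `e z` as an escaping boundary point.

If every component is eventually left, infinitely many terms lie in distinct noncompact components,
since only finitely many components are compact. Around each such term there is a chart centred at
it whose range omits `v` and `-v` and whose missing points in a large ball all escape. Opening up
`v` and `-v` into the two faces of a slab turns it into a chart with range in that slab. Slabs
shrinking to `0` give a single chart on the disjoint union, with the chosen terms converging to `0`.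
Omitting two points while fixing the centre requires that no point cuts a relatively compact piece
off a noncompact component (`not_subset_isCompact_connectedComponentIn_diff`). -/

namespace ChartBoundary

/-! ### Compactly supported diffeomorphisms of Euclidean space -/

section Euclidean

variable {E : Type*} [NormedAddCommGroup E] [NormedSpace ℝ E] [FiniteDimensional ℝ E]

/-- For small `w` the map is the identity plus a 1/2-Lipschitz term, hence a homeomorphism. The same
bound makes the derivative injective, so invertible in finite dimension, and the inverse is smooth.
-/
theorem exists_diffeomorph_add_smul (φ : E → ℝ) (hφ : ContDiff ℝ ∞ φ) (hc : HasCompactSupport φ) :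
    ∃ ε > 0, ∀ w : E, ‖w‖ < ε →
      ∃ d : Diffeomorph 𝓘(ℝ, E) 𝓘(ℝ, E) E E ∞, ∀ x, d x = x + φ x • w := by
  obtain ⟨C, hC⟩ := hφ.lipschitzWith_of_hasCompactSupport hc (by simp)
  -- `C + 1` in place of `C` allows for `C = 0`; the choice gives `C * ‖w‖ ≤ 1 / 2`.
  refine ⟨1 / (2 * (C + 1) : ℝ), by positivity, fun w hw => ?_⟩
  have hCw : C * ‖w‖ ≤ 1 / 2 := by
    rw [lt_div_iff₀ (by positivity)] at hw
    nlinarith [norm_nonneg w]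
  have hd : ContDiff ℝ ∞ fun x => x + φ x • w := contDiff_id.add (hφ.smul contDiff_const)
  have happ : ApproximatesLinearOn (fun x => x + φ x • w)
      ((ContinuousLinearEquiv.refl ℝ E : E ≃L[ℝ] E) : E →L[ℝ] E) Set.univ (1 / 2) := by
    rintro x - y -
    have h1 : x + φ x • w - (y + φ y • w) -
        ((ContinuousLinearEquiv.refl ℝ E : E ≃L[ℝ] E) : E →L[ℝ] E) (x - y)
        = (φ x - φ y) • w := by
      simp only [ContinuousLinearEquiv.coe_refl, ContinuousLinearMap.coe_id', id, sub_smul]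
      abel
    rw [h1, norm_smul]
    have h2 := hC.norm_sub_le x y
    calc ‖φ x - φ y‖ * ‖w‖ ≤ C * ‖x - y‖ * ‖w‖ := by gcongr
      _ = C * ‖w‖ * ‖x - y‖ := by ring
      _ ≤ 1 / 2 * ‖x - y‖ := by gcongr
      _ = _ := by simp
  have hN : Subsingleton E ∨
      (1 / 2 : NNReal) < ‖((ContinuousLinearEquiv.refl ℝ E).symm : E →L[ℝ] E)‖₊⁻¹ := by
    rcases subsingleton_or_nontrivial E with h | h
    · exact Or.inl h
    · right
      simp only [ContinuousLinearEquiv.refl_symm, ContinuousLinearEquiv.coe_refl]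
      have : ‖ContinuousLinearMap.id ℝ E‖₊ = 1 := by
        ext; simp
      rw [this, inv_one, one_div]
      exact NNReal.coe_lt_coe.1 (by norm_num)
  have hinj : ∀ a, Function.Injective
      (ContinuousLinearMap.id ℝ E + (fderiv ℝ φ a).smulRight w).toLinearMap := by
    intro a
    rw [← LinearMap.ker_eq_bot, LinearMap.ker_eq_bot']
    intro v hv
    have hv' : v = -(fderiv ℝ φ a v • w) := by
      rw [eq_neg_iff_add_eq_zero]; simpa using hv
    have h1 : ‖fderiv ℝ φ a v‖ ≤ C * ‖v‖ :=
      (ContinuousLinearMap.le_opNorm _ _).trans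
        (mul_le_mul_of_nonneg_right (norm_fderiv_le_of_lipschitz ℝ hC) (norm_nonneg _))
    have h2 : ‖v‖ ≤ 1 / 2 * ‖v‖ :=
      calc ‖v‖ = ‖fderiv ℝ φ a v‖ * ‖w‖ := by
            conv_lhs => rw [hv', norm_neg, norm_smul]
        _ ≤ C * ‖v‖ * ‖w‖ := by gcongr
        _ = C * ‖w‖ * ‖v‖ := by ring
        _ ≤ _ := by gcongr
    exact norm_eq_zero.1 (by linarith [norm_nonneg v])
  let D : E ≃ₜ E := happ.toHomeomorph _ hN
  have hder : ∀ a, HasFDerivAt D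
      (((LinearEquiv.ofInjectiveEndo _ (hinj a)).toContinuousLinearEquiv : E ≃L[ℝ] E) :
        E →L[ℝ] E) a := by
    intro a
    have h1 : HasFDerivAt (fun x => x + φ x • w)
        (ContinuousLinearMap.id ℝ E + (fderiv ℝ φ a).smulRight w) a :=
      (hasFDerivAt_id a).add
        ((hφ.differentiable (by simp) a).hasFDerivAt.smul_const w)
    exact h1
  refine ⟨⟨D.toEquiv, hd.contMDiff, (D.contDiff_symm hder hd).contMDiff⟩, fun x => rfl⟩

theorem exists_diffeomorph_move_in_ball (c : E) {r : ℝ} (hr : 0 < r) :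
    ∃ δ > 0, ∀ a ∈ Metric.ball c δ, ∀ b ∈ Metric.ball c δ,
      ∃ d : Diffeomorph 𝓘(ℝ, E) 𝓘(ℝ, E) E E ∞, d a = b ∧
        ∀ x, x ∉ Metric.closedBall c r → d x = x := by
  let φ : ContDiffBump c := ⟨r / 2, r, by positivity, by linarith⟩
  obtain ⟨ε, hε, h⟩ := exists_diffeomorph_add_smul φ φ.contDiff φ.hasCompactSupport
  -- The first bound puts `a` where the bump function equals 1, so that the translation vector `b -
  -- a` is applied in full; the second gives `‖b - a‖ < ε`.
  refine ⟨min (r / 2) (ε / 2), by positivity, fun a ha b hb => ?_⟩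
  have ha' := (Metric.mem_ball.1 ha).trans_le (min_le_right _ _)
  have hb' := (Metric.mem_ball.1 hb).trans_le (min_le_right _ _)
  obtain ⟨d, hd⟩ := h (b - a) (by
    rw [← dist_eq_norm]
    linarith [dist_triangle_right b a c])
  refine ⟨d, ?_, fun x hx => ?_⟩
  · rw [hd, φ.one_of_mem_closedBall, one_smul, add_sub_cancel]
    exact (Metric.mem_ball.1 ha).le.trans (min_le_left _ _)
  · rw [hd, φ.zero_of_le_dist, zero_smul, add_zero]
    exact (not_le.1 fun h => hx (Metric.mem_closedBall.2 h)).le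

end Euclidean

/-! ### Moving points by diffeomorphisms of the manifold -/

section Manifold

variable {n : ℕ} {M : Type*} [TopologicalSpace M] [T2Space M]
  [ChartedSpace (EuclideanSpace ℝ (Fin n)) M] [IsManifold (𝓡 n) ∞ M]

-- Smoothness at the edge of the chart domain holds because `e.symm '' B` is compact, hence closed
-- in a Hausdorff space, and `f` is the identity on its open complement.
omit [IsManifold (𝓡 n) ∞ M] in
theorem contMDiff_conj_chart {e : Chart n M} (he : e ∈ IsManifold.maximalAtlas (𝓡 n) ∞ M)
    {g : EuclideanSpace ℝ (Fin n) → EuclideanSpace ℝ (Fin n)} (hg : ContDiff ℝ ∞ g)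
    {B : Set (EuclideanSpace ℝ (Fin n))} (hB : IsCompact B) (hBe : B ⊆ e.target)
    (hgB : ∀ x, x ∉ B → g x = x) (hge : ∀ x ∈ e.target, g x ∈ e.target)
    {f : M → M} (hf : ∀ x ∈ e.source, f x = e.symm (g (e x)))
    (hf' : ∀ x, x ∉ e.source → f x = x) : ContMDiff (𝓡 n) (𝓡 n) ∞ f := by
  intro x
  by_cases hx : x ∈ e.source
  · have h1 : ContMDiffAt (𝓡 n) (𝓡 n) ∞ (fun x => e.symm (g (e x))) x :=
      (contMDiffAt_symm_of_mem_maximalAtlas he (hge _ (e.map_source hx))).comp x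
        (hg.contMDiff.contMDiffAt.comp x (contMDiffAt_of_mem_maximalAtlas he hx))
    exact h1.congr_of_eventuallyEq
      (Filter.eventuallyEq_of_mem (e.open_source.mem_nhds hx) hf)
  · have hcl : IsClosed (e.symm '' B) :=
      (hB.image_of_continuousOn (e.continuousOn_symm.mono hBe)).isClosed
    have hxB : x ∉ e.symm '' B := by
      rintro ⟨y, hy, rfl⟩
      exact hx (e.map_target (hBe hy))
    refine contMDiffAt_id.congr_of_eventuallyEq
      (Filter.eventuallyEq_of_mem (hcl.isOpen_compl.mem_nhds hxB) fun y hy => ?_)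
    by_cases hye : y ∈ e.source
    · rw [hf y hye, hgB, e.left_inv hye, id]
      exact fun h => hy ⟨_, h, e.left_inv hye⟩
    · exact hf' y hye

omit [IsManifold (𝓡 n) ∞ M] in
theorem exists_diffeomorph_conj_chart {e : Chart n M}
    (he : e ∈ IsManifold.maximalAtlas (𝓡 n) ∞ M)
    {B : Set (EuclideanSpace ℝ (Fin n))} (hB : IsCompact B) (hBe : B ⊆ e.target)
    (d : Diffeomorph (𝓡 n) (𝓡 n) (EuclideanSpace ℝ (Fin n)) (EuclideanSpace ℝ (Fin n)) ∞)
    (hd : ∀ x, x ∉ B → d x = x) :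
    ∃ g : Diffeomorph (𝓡 n) (𝓡 n) M M ∞, (∀ x ∈ e.source, g x = e.symm (d (e x))) ∧
      ∀ x, x ∉ e.symm '' B → g x = x := by
  classical
  have hd' : ∀ x, x ∉ B → d.symm x = x := fun x hx => by
    conv_lhs => rw [← hd x hx]
    exact d.symm_apply_apply x
  have hde : ∀ x ∈ e.target, d x ∈ e.target := by
    intro x hx
    by_cases h : d x ∈ B
    · exact hBe h
    · have : d x = x := d.injective (hd _ h)
      rwa [this]
  have hde' : ∀ x ∈ e.target, d.symm x ∈ e.target := by
    intro x hx
    by_cases h : d.symm x ∈ B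
    · exact hBe h
    · have : d.symm x = x := d.symm.injective (hd' _ h)
      rwa [this]
  let F (d : EuclideanSpace ℝ (Fin n) → EuclideanSpace ℝ (Fin n)) (x : M) : M :=
    if x ∈ e.source then e.symm (d (e x)) else x
  have hF : ∀ d, ∀ x ∈ e.source, F d x = e.symm (d (e x)) := fun d x hx => if_pos hx
  have hF' : ∀ d, ∀ x, x ∉ e.source → F d x = x := fun d x hx => if_neg hx
  refine ⟨⟨⟨F d, F d.symm, fun x => ?_, fun x => ?_⟩,
    contMDiff_conj_chart he d.contMDiff.contDiff hB hBe hd hde (hF d) (hF' d),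
    contMDiff_conj_chart he d.symm.contMDiff.contDiff hB hBe hd' hde' (hF d.symm) (hF' d.symm)⟩,
    hF d, fun x hx => ?_⟩
  · by_cases hx : x ∈ e.source
    · have h := hde _ (e.map_source hx)
      rw [hF d x hx, hF d.symm _ (e.map_target h), e.right_inv h, d.symm_apply_apply,
        e.left_inv hx]
    · rw [hF' d x hx, hF' _ x hx]
  · by_cases hx : x ∈ e.source
    · have h := hde' _ (e.map_source hx)
      rw [hF d.symm x hx, hF d _ (e.map_target h), e.right_inv h, d.apply_symm_apply,
        e.left_inv hx]
    · rw [hF' d.symm x hx, hF' _ x hx]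
  · change F d x = x
    by_cases hxe : x ∈ e.source
    · rw [hF d x hxe, hd, e.left_inv hxe]
      exact fun h => hx ⟨_, h, e.left_inv hxe⟩
    · exact hF' d x hxe

theorem exists_nhds_diffeomorph_move (a : M) {V : Set M} (hV : V ∈ 𝓝 a) :
    ∃ N ∈ 𝓝 a, N ⊆ V ∧ ∀ b ∈ N, ∀ c ∈ N,
      ∃ g : Diffeomorph (𝓡 n) (𝓡 n) M M ∞, g b = c ∧ ∀ x, x ∉ V → g x = x := by
  let e : Chart n M := chartAt (EuclideanSpace ℝ (Fin n)) a
  have he : e ∈ IsManifold.maximalAtlas (𝓡 n) ∞ M := IsManifold.chart_mem_maximalAtlas a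
  have ha : a ∈ e.source := mem_chart_source _ a
  have hW : e.target ∩ e.symm ⁻¹' V ∈ 𝓝 (e a) := by
    refine Filter.inter_mem (e.open_target.mem_nhds (e.map_source ha)) ?_
    refine (e.continuousAt_symm (e.map_source ha)) ?_
    rwa [e.left_inv ha]
  obtain ⟨r, hr, hrW⟩ := Metric.nhds_basis_closedBall.mem_iff.1 hW
  obtain ⟨δ, hδ, h⟩ := exists_diffeomorph_move_in_ball (e a) hr
  refine ⟨V ∩ (e.source ∩ e ⁻¹' Metric.ball (e a) δ), Filter.inter_mem hV
    (Filter.inter_mem (e.open_source.mem_nhds ha)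
      (e.continuousAt ha (Metric.ball_mem_nhds _ hδ))), Set.inter_subset_left, ?_⟩
  rintro b ⟨-, hb, hbδ⟩ c ⟨-, hc, hcδ⟩
  obtain ⟨d, hd, hd'⟩ := h _ hbδ _ hcδ
  obtain ⟨g, hg, hg'⟩ := exists_diffeomorph_conj_chart he (isCompact_closedBall (e a) r)
    (fun x hx => (hrW hx).1) d hd'
  refine ⟨g, by rw [hg b hb, hd, e.left_inv hc], fun x hx => hg' x ?_⟩
  rintro ⟨y, hy, rfl⟩
  exact hx (hrW hy).2

/-- Diffeomorphisms supported in an open connected set act transitively on it. -/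
theorem exists_diffeomorph_move {V : Set M} (hV : IsOpen V) (hVc : IsPreconnected V)
    {a b : M} (ha : a ∈ V) (hb : b ∈ V) :
    ∃ g : Diffeomorph (𝓡 n) (𝓡 n) M M ∞, g a = b ∧ ∀ x, x ∉ V → g x = x := by
  let R (b : M) : Prop :=
    ∃ g : Diffeomorph (𝓡 n) (𝓡 n) M M ∞, g a = b ∧ ∀ x, x ∉ V → g x = x
  have htr : ∀ b c, R b → (∃ g : Diffeomorph (𝓡 n) (𝓡 n) M M ∞,
      g b = c ∧ ∀ x, x ∉ V → g x = x) → R c := by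
    rintro b c ⟨g, hg, hg'⟩ ⟨k, hk, hk'⟩
    refine ⟨g.trans k, ?_, fun x hx => ?_⟩
    · simp [hg, hk]
    · simp [hg' x hx, hk' x hx]
  have hloc : ∀ b ∈ V, ∃ N ∈ 𝓝 b, N ⊆ V ∧ ∀ c ∈ N, ∀ c' ∈ N, R c → R c' := by
    intro b hb
    obtain ⟨N, hN, hNV, h⟩ := exists_nhds_diffeomorph_move (n := n) b (hV.mem_nhds hb)
    exact ⟨N, hN, hNV, fun c hc c' hc' hR => htr c c' hR (h c hc c' hc')⟩
  -- Nearby points can be exchanged, so the orbit of `a` in `V` and its complement in `V` are both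
  -- open.
  have h1 : IsOpen {b | b ∈ V ∧ R b} := isOpen_iff_mem_nhds.2 fun b hb => by
    obtain ⟨N, hN, hNV, h⟩ := hloc b hb.1
    exact Filter.mem_of_superset hN fun c hc => ⟨hNV hc, h b (mem_of_mem_nhds hN) c hc hb.2⟩
  have h2 : IsOpen {b | b ∈ V ∧ ¬ R b} := isOpen_iff_mem_nhds.2 fun b hb => by
    obtain ⟨N, hN, hNV, h⟩ := hloc b hb.1
    exact Filter.mem_of_superset hN fun c hc =>
      ⟨hNV hc, fun hR => hb.2 (h c hc b (mem_of_mem_nhds hN) hR)⟩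
  have h3 := hVc.subset_left_of_subset_union h1 h2
    (Set.disjoint_left.2 fun x hx hx' => hx'.2 hx.2)
    (fun x hx => (em (R x)).imp (⟨hx, ·⟩) (⟨hx, ·⟩))
    ⟨a, ha, ha, Diffeomorph.refl _ _ _, rfl, fun x _ => rfl⟩
  exact (h3 hb).2

end Manifold

/-! ### Components of complements and ends -/

section Components

variable {X : Type*} [TopologicalSpace X]

/-- Adjoining limit points to a connected set keeps it connected, so components of `F` are closed
relative to `F`. -/
theorem closure_connectedComponentIn_inter_subset (F : Set X) (x : X) :
    closure (connectedComponentIn F x) ∩ F ⊆ connectedComponentIn F x := by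
  by_cases hx : x ∈ F
  · refine IsPreconnected.subset_connectedComponentIn ?_
      ⟨subset_closure (mem_connectedComponentIn hx), hx⟩ Set.inter_subset_right
    exact isPreconnected_connectedComponentIn.subset_closure
      (Set.subset_inter subset_closure (connectedComponentIn_subset F x)) Set.inter_subset_left
  · simp [connectedComponentIn_eq_empty hx]

variable [LocallyConnectedSpace X]

/-- A component of a punctured connected open set accumulates at the puncture. -/
theorem mem_closure_connectedComponentIn_diff [T1Space X] {V : Set X} (hV : IsOpen V)
    (hVc : IsPreconnected V) {a b : X} (ha : a ∈ V) (hb : b ∈ V) (hab : b ≠ a) :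
    a ∈ closure (connectedComponentIn (V \ {a}) b) := by
  by_contra h
  set D := connectedComponentIn (V \ {a}) b with hD
  have hDo : IsOpen D := (hV.sdiff isClosed_singleton).connectedComponentIn
  have hbD : b ∈ D := mem_connectedComponentIn ⟨hb, hab⟩
  have h1 : V ⊆ D := hVc.subset_left_of_subset_union hDo isClosed_closure.isOpen_compl
    (disjoint_compl_right.mono_left subset_closure) (fun z hz => by
      by_cases hz' : z ∈ closure D
      · exact Or.inl (closure_connectedComponentIn_inter_subset _ _
          ⟨hz', hz, fun hza => h (by rwa [Set.mem_singleton_iff.1 hza] at hz')⟩)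
      · exact Or.inr hz') ⟨b, hb, hbD⟩
  exact (connectedComponentIn_subset _ _ (h1 ha)).2 rfl

theorem isPreconnected_insert_connectedComponentIn_diff [T1Space X] {V : Set X} (hV : IsOpen V)
    (hVc : IsPreconnected V) {a b : X} (ha : a ∈ V) (hb : b ∈ V) (hab : b ≠ a) :
    IsPreconnected (insert a (connectedComponentIn (V \ {a}) b)) :=
  isPreconnected_connectedComponentIn.subset_closure (Set.subset_insert _ _)
    (Set.insert_subset (mem_closure_connectedComponentIn_diff hV hVc ha hb hab) subset_closure)

/-- An ultrafilter of a component that escapes every compact set selects, for every compact set, an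
open connected subset of its complement. -/
theorem exists_isPreconnected_mem_ultrafilter [LocallyCompactSpace X] [T2Space X]
    {𝒰 : Ultrafilter X} (h𝒰 : (𝒰 : Filter X) ≤ cocompact X) {x₀ : X}
    (h₀ : connectedComponent x₀ ∈ 𝒰) {K : Set X} (hK : IsCompact K) :
    ∃ V ∈ 𝒰, IsOpen V ∧ IsPreconnected V ∧ Disjoint V K := by
  by_cases hd : Disjoint (connectedComponent x₀) K
  · exact ⟨_, h₀, isOpen_connectedComponent, isPreconnected_connectedComponent, hd⟩
  obtain ⟨L, hL, hKL⟩ := exists_compact_superset hK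
  have hfr : IsCompact (frontier L) := hL.of_isClosed_subset isClosed_frontier
    hL.isClosed.frontier_subset
  have hfK : frontier L ⊆ Kᶜ := fun z hz hzK => hz.2 (hKL hzK)
  obtain ⟨t, -, htc⟩ := hfr.elim_nhds_subcover (fun z => connectedComponentIn Kᶜ z)
    (fun z hz => hK.isClosed.isOpen_compl.connectedComponentIn.mem_nhds
      (mem_connectedComponentIn (hfK hz)))
  -- Finitely many components of `Kᶜ` cover `frontier L`. A component of `Kᶜ` through a point
  -- outside `L` that missed `frontier L` would stay outside `L`, hence be clopen in `X`, hence
  -- contain the component of `x₀`, which meets `K`.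
  have hcov : connectedComponent x₀ ∩ Lᶜ ⊆ ⋃ z ∈ (t : Set X), connectedComponentIn Kᶜ z := by
    rintro x ⟨hx₀, hxL⟩
    have hxK : x ∈ Kᶜ := fun h => hxL (interior_subset (hKL h))
    by_cases hW : (connectedComponentIn Kᶜ x ∩ frontier L).Nonempty
    · obtain ⟨z, hzW, hzL⟩ := hW
      obtain ⟨w, hw, hzw⟩ := Set.mem_iUnion₂.1 (htc hzL)
      refine Set.mem_iUnion₂.2 ⟨w, hw, ?_⟩
      rw [connectedComponentIn_eq hzw, ← connectedComponentIn_eq hzW]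
      exact mem_connectedComponentIn hxK
    · exfalso
      have h1 : connectedComponentIn Kᶜ x ⊆ (closure L)ᶜ :=
        isPreconnected_connectedComponentIn.subset_right_of_subset_union isOpen_interior
          isClosed_closure.isOpen_compl
          (disjoint_compl_right.mono_left (interior_subset.trans subset_closure))
          (fun z hz => by
            by_contra hcon
            rw [Set.mem_union, not_or, Set.mem_compl_iff, not_not] at hcon
            exact hW ⟨z, hz, hcon.2, hcon.1⟩)
          ⟨x, mem_connectedComponentIn hxK, by rwa [hL.isClosed.closure_eq]⟩
      have h2 : closure (connectedComponentIn Kᶜ x) ⊆ Kᶜ := by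
        refine (closure_mono (h1.trans (Set.compl_subset_compl.2 subset_closure))).trans ?_
        rw [closure_compl]
        exact Set.compl_subset_compl.2 hKL
      have h3 : IsClopen (connectedComponentIn Kᶜ x) :=
        ⟨isClosed_of_closure_subset fun z hz =>
          closure_connectedComponentIn_inter_subset _ _ ⟨hz, h2 hz⟩,
          hK.isClosed.isOpen_compl.connectedComponentIn⟩
      have h4 := h3.connectedComponent_subset (mem_connectedComponentIn hxK)
      rw [← connectedComponent_eq hx₀] at h4
      exact hd (Set.disjoint_left.2 fun z hz => connectedComponentIn_subset _ _ (h4 hz))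
  have hmem : connectedComponent x₀ ∩ Lᶜ ∈ 𝒰 :=
    Filter.inter_mem h₀ (h𝒰 hL.compl_mem_cocompact)
  -- An ultrafilter containing a finite union contains one of its members.
  obtain ⟨z, -, hz⟩ := (Ultrafilter.finite_biUnion_mem_iff t.finite_toSet).1
    (Filter.mem_of_superset hmem hcov)
  exact ⟨_, hz, hK.isClosed.isOpen_compl.connectedComponentIn,
    isPreconnected_connectedComponentIn,
    disjoint_compl_left.mono_left (connectedComponentIn_subset _ _)⟩

/-- An exhaustion by compact sets together with a chain of points in the selected connected
pieces of the complements. -/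
theorem exists_exhaustion_chain [LocallyCompactSpace X] [T2Space X] [SigmaCompactSpace X]
    {𝒰 : Ultrafilter X} (h𝒰 : (𝒰 : Filter X) ≤ cocompact X) {x₀ : X}
    (h₀ : connectedComponent x₀ ∈ 𝒰) {K₀ V₀ S : Set X} (hK₀ : IsCompact K₀)
    (hV₀ : V₀ ∈ 𝒰) (hV₀o : IsOpen V₀) (hV₀c : IsPreconnected V₀) (hVK : Disjoint V₀ K₀)
    {y₀ : X} (hy₀ : y₀ ∈ V₀) (hS : S ∈ 𝒰) :
    ∃ (K V : ℕ → Set X) (y : ℕ → X), K 0 = K₀ ∧ y 0 = y₀ ∧ Monotone K ∧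
      (∀ x, ∃ k, K k ∈ 𝓝 x) ∧ (∀ k, IsOpen (V k)) ∧ (∀ k, IsPreconnected (V k)) ∧
      (∀ k, Disjoint (V k) (K k)) ∧ (∀ k, (V k ∩ V (k + 1)).Nonempty) ∧ (∀ k, y k ∈ V k) ∧
      (∀ k, y k ∈ K (k + 1)) ∧ ∀ k, y (k + 1) ∈ S := by
  let T := {s : Set X × Set X × X // IsCompact s.1 ∧ s.2.1 ∈ 𝒰 ∧ IsOpen s.2.1 ∧
    IsPreconnected s.2.1 ∧ Disjoint s.2.1 s.1 ∧ s.2.2 ∈ s.2.1}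
  have Q : CompactExhaustion X := default
  -- The next compact set absorbs `Q k` to exhaust `X`, the previous set for monotonicity, and the
  -- current point so that later pieces avoid it.
  have step : ∀ (k : ℕ) (s : T), ∃ s' : T, s'.1.1 = Q k ∪ s.1.1 ∪ {s.1.2.2} ∧ s'.1.2.2 ∈ S := by
    rintro k ⟨⟨K, V, y⟩, hK, hV, hVo, hVc, hd, hy⟩
    have hK' : IsCompact (Q k ∪ K ∪ {y}) := ((Q.isCompact k).union hK).union isCompact_singleton
    obtain ⟨V', hV', hV'o, hV'c, hd'⟩ := exists_isPreconnected_mem_ultrafilter h𝒰 h₀ hK'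
    obtain ⟨y', hy', hyS⟩ := 𝒰.nonempty_of_mem (Filter.inter_mem hV' hS)
    exact ⟨⟨(_, V', y'), hK', hV', hV'o, hV'c, hd', hy'⟩, rfl, hyS⟩
  choose next hnext hnextS using step
  let s : ℕ → T := fun k =>
    Nat.rec ⟨(K₀, V₀, y₀), hK₀, hV₀, hV₀o, hV₀c, hVK, hy₀⟩ (fun k s => next k s) k
  have hs : ∀ k, s (k + 1) = next k (s k) := fun k => rfl
  have hK : ∀ k, (s (k + 1)).1.1 = Q k ∪ (s k).1.1 ∪ {(s k).1.2.2} := fun k => by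
    rw [hs, hnext]
  refine ⟨fun k => (s k).1.1, fun k => (s k).1.2.1, fun k => (s k).1.2.2, rfl, rfl,
    monotone_nat_of_le_succ fun k => ?_, fun x => ?_, fun k => (s k).2.2.2.1,
    fun k => (s k).2.2.2.2.1, fun k => (s k).2.2.2.2.2.1,
    fun k => 𝒰.nonempty_of_mem (Filter.inter_mem (s k).2.2.1 (s (k + 1)).2.2.1),
    fun k => (s k).2.2.2.2.2.2, fun k => ?_, fun k => hnextS k (s k)⟩
  · rw [hK]
    exact fun z hz => Or.inl (Or.inr hz)
  · obtain ⟨k, hk⟩ := Q.exists_mem_nhds x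
    refine ⟨k + 1, Filter.mem_of_superset hk ?_⟩
    beta_reduce
    rw [hK]
    exact fun z hz => Or.inl (Or.inl hz)
  · beta_reduce
    rw [hK]
    exact Or.inr rfl

end Components

/-! ### Pushing a point to infinity -/

section Push

variable {n : ℕ} {M : Type*} [TopologicalSpace M] [T2Space M]
  [ChartedSpace (EuclideanSpace ℝ (Fin n)) M] [IsManifold (𝓡 n) ∞ M]

/-- A diffeomorphism supported in a connected open set moving `b` to `a` and `a` only slightly. -/
theorem exists_diffeomorph_move_near {V : Set M} (hV : IsOpen V) (hVc : IsPreconnected V)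
    {a b : M} (ha : a ∈ V) (hb : b ∈ V) (hab : b ≠ a) {O : Set M} (hO : O ∈ 𝓝 a) :
    ∃ g : Diffeomorph (𝓡 n) (𝓡 n) M M ∞, g b = a ∧ g a ∈ O ∧ ∀ x, x ∉ V → g x = x := by
  have : LocallyConnectedSpace M :=
    ChartedSpace.locallyConnectedSpace (EuclideanSpace ℝ (Fin n)) M
  -- The move has two stages: `g` brings `b` to some `b'` near `a` inside a component of `V \ {a}`,
  -- hence fixes `a`; then `k`, supported in `O ∩ V`, takes `b'` to `a`.
  obtain ⟨N, hN, hNO, hmove⟩ := exists_nhds_diffeomorph_move (n := n) a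
    (Filter.inter_mem hO (hV.mem_nhds ha))
  obtain ⟨b', hb'N, hb'⟩ := mem_closure_iff_nhds.1
    (mem_closure_connectedComponentIn_diff hV hVc ha hb hab) N hN
  obtain ⟨g, hg, hg'⟩ := exists_diffeomorph_move (n := n)
    (hV.sdiff isClosed_singleton).connectedComponentIn isPreconnected_connectedComponentIn
    (mem_connectedComponentIn ⟨hb, hab⟩) hb'
  obtain ⟨k, hk, hk'⟩ := hmove b' hb'N a (mem_of_mem_nhds hN)
  have hga : g a = a := hg' a fun h => (connectedComponentIn_subset _ _ h).2 rfl
  refine ⟨g.trans k, by simp [hg, hk], ?_, fun x hx => ?_⟩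
  · change k (g a) ∈ O
    rw [hga]
    -- If `k a` were outside `O`, it would be fixed by `k`, so injectivity would give `k a = a ∈ O`.
    by_contra h
    have h1 : k (k a) = k a := hk' _ fun h' => h h'.1
    have h2 : k a = a := k.injective h1
    exact h (by rw [h2]; exact mem_of_mem_nhds hO)
  · have h1 : g x = x := hg' x fun h => hx (connectedComponentIn_subset _ _ h).1
    change k (g x) = x
    rw [h1]
    exact hk' x fun h => hx h.2

/-- Injective self-maps of a manifold agreeing locally with diffeomorphisms of the whole
manifold. -/
structure IsSelfEmbedding (n : ℕ) {M : Type*} [TopologicalSpace M]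
    [ChartedSpace (EuclideanSpace ℝ (Fin n)) M] (f : M → M) : Prop where
  injective : Function.Injective f
  locally_eq : ∀ x, ∃ g : Diffeomorph (𝓡 n) (𝓡 n) M M ∞, f =ᶠ[𝓝 x] g

/-- Diffeomorphisms `F k` with `F k (y k) = y 0` are built by precomposing with moves supported in
`V k ∪ V (k + 1)`, away from `K k`. They stabilise on each `K k`, so the limit is locally a
diffeomorphism of `M` and injective. The preimage of `y 0` under `F k` is `y k`, which runs off to
infinity, so the limit misses `y 0`. -/
theorem exists_isSelfEmbedding_of_chain {K V : ℕ → Set M} {y : ℕ → M} (hK : Monotone K)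
    (hKx : ∀ x, ∃ k, K k ∈ 𝓝 x) (hVo : ∀ k, IsOpen (V k)) (hVc : ∀ k, IsPreconnected (V k))
    (hVK : ∀ k, Disjoint (V k) (K k)) (hVV : ∀ k, (V k ∩ V (k + 1)).Nonempty)
    (hy : ∀ k, y k ∈ V k) (hyK : ∀ k, y k ∈ K (k + 1)) {C : Set M} (hC : C ∈ 𝓝 (y 0)) :
    ∃ f : M → M, IsSelfEmbedding n f ∧ y 0 ∉ Set.range f ∧ (∀ x ∈ K 0, f x = x) ∧
      ∀ k, f (y k) ∈ C := by
  have step : ∀ (k : ℕ) (f : {f : Diffeomorph (𝓡 n) (𝓡 n) M M ∞ // f (y k) = y 0}),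
      ∃ f' : {f : Diffeomorph (𝓡 n) (𝓡 n) M M ∞ // f (y (k + 1)) = y 0},
        f'.1 (y k) ∈ C ∧ ∀ x ∈ K k, f'.1 x = f.1 x := by
    rintro k ⟨f, hf⟩
    obtain ⟨z, hz, hz'⟩ := hVV k
    have hO : f ⁻¹' C ∈ 𝓝 (y k) := f.continuous.continuousAt (by rwa [hf])
    -- `g` takes `y (k + 1)` to `y k`, which carries the invariant on, and displaces `y k` so little
    -- that its image under `f` is still in `C`.
    obtain ⟨g, hg, hgO, hg'⟩ := exists_diffeomorph_move_near (n := n) ((hVo k).union (hVo (k + 1)))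
      (IsPreconnected.union z hz hz' (hVc k) (hVc (k + 1))) (Or.inl (hy k)) (Or.inr (hy (k + 1)))
      (fun h => Set.disjoint_left.1 (hVK (k + 1)) (hy (k + 1)) (h ▸ hyK k)) hO
    refine ⟨⟨g.trans f, by simp [hg, hf]⟩, hgO, fun x hx => ?_⟩
    change f (g x) = f x
    rw [hg' x]
    rintro (h | h)
    · exact Set.disjoint_left.1 (hVK k) h hx
    · exact Set.disjoint_left.1 (hVK (k + 1)) h (hK (Nat.le_succ k) hx)
  choose next hnextC hnext using step
  let F : ∀ k, {f : Diffeomorph (𝓡 n) (𝓡 n) M M ∞ // f (y k) = y 0} := fun k =>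
    Nat.rec ⟨Diffeomorph.refl _ _ _, rfl⟩ (fun k f => next k f) k
  have hF : ∀ k j, k ≤ j → ∀ x ∈ K k, (F j).1 x = (F k).1 x := by
    intro k j hkj x hx
    induction j, hkj using Nat.le_induction with
    | base => rfl
    | succ j hkj ih => rw [← ih]; exact hnext j (F j) x (hK hkj hx)
  choose N hN using hKx
  have hlim : ∀ k, ∀ x ∈ K k, (F (N x)).1 x = (F k).1 x := by
    intro k x hx
    rw [← hF k (max k (N x)) (le_max_left _ _) x hx,
      ← hF (N x) (max k (N x)) (le_max_right _ _) x (mem_of_mem_nhds (hN x))]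
  refine ⟨fun x => (F (N x)).1 x, ⟨fun x x' h => ?_, fun x => ⟨(F (N x)).1, ?_⟩⟩, ?_,
    fun x hx => hlim 0 x hx, fun k => ?_⟩
  · have hx : x ∈ K (max (N x) (N x')) := hK (le_max_left _ _) (mem_of_mem_nhds (hN x))
    have hx' : x' ∈ K (max (N x) (N x')) := hK (le_max_right _ _) (mem_of_mem_nhds (hN x'))
    refine (F (max (N x) (N x'))).1.injective ?_
    change (F (max (N x) (N x'))).1 x = (F (max (N x) (N x'))).1 x'
    rw [← hlim _ x hx, ← hlim _ x' hx']
    exact h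
  · exact Filter.eventuallyEq_of_mem (hN x) fun z hz => hlim _ z hz
  · rintro ⟨z, hz⟩
    -- A preimage `z` would equal `y (N z)`, which lies outside `K (N z)`, although `K (N z)` is a
    -- neighbourhood of `z`.
    have h1 : z = y (N z) := (F (N z)).1.injective (hz.trans (F (N z)).2.symm)
    exact Set.disjoint_left.1 (hVK (N z)) (hy (N z)) (h1 ▸ mem_of_mem_nhds (hN z))
  · change (F (N (y k))).1 (y k) ∈ C
    rw [hlim (k + 1) _ (hyK k)]
    exact hnextC k (F k)

/-- A point can be pushed to infinity along any ultrafilter escaping every compact set: the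
resulting embedding of `M` into itself misses the point. -/
theorem exists_isSelfEmbedding_notMem_range [SigmaCompactSpace M]
    {𝒰 : Ultrafilter M} (h𝒰 : (𝒰 : Filter M) ≤ cocompact M) {x₀ : M}
    (h₀ : connectedComponent x₀ ∈ 𝒰) {K₀ V₀ S C : Set M} (hK₀ : IsCompact K₀)
    (hV₀ : V₀ ∈ 𝒰) (hV₀o : IsOpen V₀) (hV₀c : IsPreconnected V₀) (hVK : Disjoint V₀ K₀)
    {y₀ : M} (hy₀ : y₀ ∈ V₀) (hS : S ∈ 𝒰) (hC : C ∈ 𝓝 y₀) :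
    ∃ f : M → M, IsSelfEmbedding n f ∧ y₀ ∉ Set.range f ∧ (∀ x ∈ K₀, f x = x) ∧
      {z ∈ S | f z ∈ C}.Infinite := by
  have : LocallyConnectedSpace M :=
    ChartedSpace.locallyConnectedSpace (EuclideanSpace ℝ (Fin n)) M
  have : LocallyCompactSpace M :=
    ChartedSpace.locallyCompactSpace (EuclideanSpace ℝ (Fin n)) M
  obtain ⟨K, V, y, rfl, rfl, hK, hKx, hVo, hVc, hVK, hVV, hy, hyK, hyS⟩ :=
    exists_exhaustion_chain h𝒰 h₀ hK₀ hV₀ hV₀o hV₀c hVK hy₀ hS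
  obtain ⟨f, hf, hfy, hfK, hfC⟩ :=
    exists_isSelfEmbedding_of_chain (n := n) hK hKx hVo hVc hVK hVV hy hyK hC
  refine ⟨f, hf, hfy, hfK, ?_⟩
  have hne : ∀ k j, k < j → y k ≠ y j := fun k j hkj h =>
    Set.disjoint_left.1 (hVK j) (hy j) (h ▸ hK hkj (hyK k))
  -- The shift by one is needed because the starting point `y 0` need not lie in `S`.
  have hinj : Function.Injective fun k => y (k + 1) := by
    intro k j h
    by_contra hkj
    rcases lt_or_gt_of_ne hkj with h' | h'
    · exact hne _ _ (Nat.succ_lt_succ h') h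
    · exact hne _ _ (Nat.succ_lt_succ h') h.symm
  refine (Set.infinite_range_of_injective hinj).mono ?_
  rintro _ ⟨k, rfl⟩
  exact ⟨hyS k, hfC (k + 1)⟩

end Push

/-! ### Charts pulled back by self-embeddings and their escaping boundary points -/

section Charts

variable {n : ℕ} {M : Type*} [TopologicalSpace M]
  [ChartedSpace (EuclideanSpace ℝ (Fin n)) M] [IsManifold (𝓡 n) ∞ M]

/-- An injective map on an open set which agrees locally with charts of the maximal atlas is a chart
of the maximal atlas. -/
theorem exists_chart_of_locally_eq [Nonempty M] {D : Set M} (hD : IsOpen D)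
    {a : M → EuclideanSpace ℝ (Fin n)} (ha : Set.InjOn a D)
    (h : ∀ x ∈ D, ∃ φ ∈ IsManifold.maximalAtlas (𝓡 n) ∞ M, x ∈ φ.source ∧ a =ᶠ[𝓝 x] φ) :
    ∃ α ∈ IsManifold.maximalAtlas (𝓡 n) ∞ M, α.source = D ∧ ⇑α = a := by
  classical
  have hcont : ContinuousOn a D := fun x hx => by
    obtain ⟨φ, -, hxφ, hφ⟩ := h x hx
    exact ((φ.continuousAt hxφ).congr hφ.symm).continuousWithinAt
  have hopen : IsOpenMap (D.domRestrict a) := by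
    refine isOpenMap_iff_nhds_le.2 ?_
    rintro ⟨x, hx⟩
    obtain ⟨φ, -, hxφ, hφ⟩ := h x hx
    have h1 : Filter.map (D.domRestrict a) (𝓝 ⟨x, hx⟩) = 𝓝 (a x) := by
      have : D.domRestrict a = a ∘ (Subtype.val : D → M) := rfl
      rw [this, ← Filter.map_map, map_nhds_subtype_coe_eq_nhds hx (hD.mem_nhds hx),
        Filter.map_congr hφ, φ.map_nhds_eq hxφ, hφ.self_of_nhds]
    exact h1.ge
  let α : Chart n M := OpenPartialHomeomorph.ofContinuousOpenRestrict
    (ha.toPartialEquiv a D) hcont hopen hD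
  have hα : ⇑α = a := rfl
  have hαs : α.source = D := rfl
  refine ⟨α, α.mem_maximalAtlas_of_contMDiffOn ?_ ?_, rfl, rfl⟩
  · intro x hx
    obtain ⟨φ, hφ, hxφ, hφa⟩ := h x hx
    exact ((contMDiffAt_of_mem_maximalAtlas hφ hxφ).congr_of_eventuallyEq
      hφa).contMDiffWithinAt
  · intro y hy
    have hx : α.symm y ∈ D := α.map_target hy
    obtain ⟨φ, hφ, hxφ, hφa⟩ := h _ hx
    have hy' : φ (α.symm y) = y := by
      rw [← hφa.self_of_nhds]; exact α.right_inv hy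
    have hyφ : y ∈ φ.target := hy' ▸ φ.map_source hxφ
    have hφy : φ.symm y = α.symm y := by
      conv_lhs => rw [← hy']
      exact φ.left_inv hxφ
    have hev : ⇑α.symm =ᶠ[𝓝 y] φ.symm := by
      have h1 : Tendsto φ.symm (𝓝 y) (𝓝 (α.symm y)) := by
        rw [← hφy]; exact φ.continuousAt_symm hyφ
      filter_upwards [h1 hφa, h1 (hD.mem_nhds hx), φ.open_target.mem_nhds hyφ] with z hz hzD hzφ
      have h2 : α (φ.symm z) = z := hz.trans (φ.right_inv hzφ)
      conv_lhs => rw [← h2]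
      exact α.left_inv hzD
    exact ((contMDiffAt_symm_of_mem_maximalAtlas hφ hyφ).congr_of_eventuallyEq
      hev).contMDiffWithinAt

theorem diffeomorph_trans_mem_maximalAtlas {e : Chart n M}
    (he : e ∈ IsManifold.maximalAtlas (𝓡 n) ∞ M) (g : Diffeomorph (𝓡 n) (𝓡 n) M M ∞) :
    g.toHomeomorph.toOpenPartialHomeomorph ≫ₕ e ∈ IsManifold.maximalAtlas (𝓡 n) ∞ M := by
  refine OpenPartialHomeomorph.mem_maximalAtlas_of_contMDiffOn _ ?_ ?_
  · exact (contMDiffOn_of_mem_maximalAtlas he).comp g.contMDiff.contMDiffOn fun x hx => hx.2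
  · exact g.symm.contMDiff.comp_contMDiffOn
      ((contMDiffOn_symm_of_mem_maximalAtlas he).mono fun x hx => hx.1)

theorem trans_mem_maximalAtlas {e : Chart n M}
    (he : e ∈ IsManifold.maximalAtlas (𝓡 n) ∞ M)
    (τ : OpenPartialHomeomorph (EuclideanSpace ℝ (Fin n)) (EuclideanSpace ℝ (Fin n)))
    (hτ : ContDiffOn ℝ ∞ τ τ.source) (hτ' : ContDiffOn ℝ ∞ τ.symm τ.target) :
    e ≫ₕ τ ∈ IsManifold.maximalAtlas (𝓡 n) ∞ M := by
  refine OpenPartialHomeomorph.mem_maximalAtlas_of_contMDiffOn _ ?_ ?_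
  · exact hτ.contMDiffOn.comp ((contMDiffOn_of_mem_maximalAtlas he).mono fun x hx => hx.1)
      fun x hx => hx.2
  · exact (contMDiffOn_symm_of_mem_maximalAtlas he).comp
      (hτ'.contMDiffOn.mono fun x hx => hx.1) fun x hx => hx.2

omit [IsManifold (𝓡 n) ∞ M] in
theorem IsSelfEmbedding.continuous {f : M → M} (hf : IsSelfEmbedding n f) : Continuous f :=
  continuous_iff_continuousAt.2 fun x => by
    obtain ⟨g, hg⟩ := hf.locally_eq x
    exact g.continuous.continuousAt.congr hg.symm

omit [IsManifold (𝓡 n) ∞ M] in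
theorem IsSelfEmbedding.map_nhds_eq {f : M → M} (hf : IsSelfEmbedding n f) (x : M) :
    Filter.map f (𝓝 x) = 𝓝 (f x) := by
  obtain ⟨g, hg⟩ := hf.locally_eq x
  rw [Filter.map_congr hg, hg.self_of_nhds]
  exact g.toHomeomorph.map_nhds_eq x

omit [IsManifold (𝓡 n) ∞ M] in
theorem IsSelfEmbedding.comp {f f' : M → M} (hf : IsSelfEmbedding n f)
    (hf' : IsSelfEmbedding n f') : IsSelfEmbedding n (f ∘ f') := by
  refine ⟨hf.injective.comp hf'.injective, fun x => ?_⟩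
  obtain ⟨g', hg'⟩ := hf'.locally_eq x
  obtain ⟨g, hg⟩ := hf.locally_eq (f' x)
  refine ⟨g'.trans g, ?_⟩
  filter_upwards [hg', hf'.continuous.continuousAt hg] with z hz hz'
  have h1 : f (f' z) = g (f' z) := hz'
  change f (f' z) = g (g' z)
  rw [h1, hz]

/-- Pulling back a chart under a self-embedding. -/
theorem IsSelfEmbedding.exists_chart [Nonempty M] {f : M → M} (hf : IsSelfEmbedding n f)
    {e : Chart n M} (he : e ∈ IsManifold.maximalAtlas (𝓡 n) ∞ M) {D : Set M} (hD : IsOpen D) :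
    ∃ β ∈ IsManifold.maximalAtlas (𝓡 n) ∞ M, β.source = D ∩ f ⁻¹' e.source ∧ ⇑β = e ∘ f := by
  refine exists_chart_of_locally_eq (hD.inter (e.open_source.preimage hf.continuous))
    (e.injOn.comp hf.injective.injOn fun x hx => hx.2) fun x hx => ?_
  obtain ⟨g, hg⟩ := hf.locally_eq x
  refine ⟨_, diffeomorph_trans_mem_maximalAtlas he g, ⟨Set.mem_univ _, ?_⟩, ?_⟩
  · have := hx.2
    rwa [Set.mem_preimage, hg.self_of_nhds] at this
  · filter_upwards [hg] with z hz
    change e (f z) = e (g z)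
    rw [hz]

/-- Points of the domain of `α` with `α`-coordinates tending to `p` do not accumulate in `M`. -/
def EscapesAt (α : Chart n M) (p : EuclideanSpace ℝ (Fin n)) : Prop :=
  ∀ m : M, Disjoint (𝓝 m) (Filter.comap α (𝓝 p) ⊓ 𝓟 α.source)

omit [IsManifold (𝓡 n) ∞ M] in
/-- Where the image of the pulled back chart stops, the coordinates escape from `M`. -/
theorem IsSelfEmbedding.escapesAt [T2Space M] {f : M → M} (hf : IsSelfEmbedding n f)
    {e β : Chart n M} {D : Set M} (hD : IsClosed D) (hβs : β.source = D ∩ f ⁻¹' e.source)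
    (hβ : ⇑β = e ∘ f) {p : EuclideanSpace ℝ (Fin n)} (hp : p ∈ e.target) (hpβ : p ∉ β.target) :
    EscapesAt β p := by
  intro m
  -- For `m ∈ D`, `f m = e.symm p` would put `p` in `β.target`, so the two points can be separated.
  -- For `m ∉ D`, the closed set `D` contains the whole domain of `β`.
  by_cases hm : m ∈ D
  · have hne : f m ≠ e.symm p := by
      intro h
      refine hpβ ?_
      have h1 : m ∈ β.source := by
        rw [hβs]
        exact ⟨hm, by rw [Set.mem_preimage, h]; exact e.map_target hp⟩
      have h2 : β m = p := by
        rw [hβ, Function.comp_apply, h, e.right_inv hp]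
      rw [← h2]
      exact β.map_source h1
    obtain ⟨A, B, hA, hB, hmA, hpB, hAB⟩ := t2_separation hne
    rw [Filter.disjoint_iff]
    have hB' : e.symm ⁻¹' B ∈ 𝓝 p := (e.continuousAt_symm hp) (hB.mem_nhds hpB)
    refine ⟨f ⁻¹' A, hf.continuous.continuousAt (hA.mem_nhds hmA), β ⁻¹' (e.symm ⁻¹' B) ∩ β.source,
      Filter.inter_mem_inf (Filter.preimage_mem_comap hB') (Filter.mem_principal_self _), ?_⟩
    refine Set.disjoint_left.2 ?_
    rintro z hzA ⟨hzB, hz⟩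
    rw [hβs] at hz
    refine Set.disjoint_left.1 hAB hzA ?_
    rw [Set.mem_preimage, Set.mem_preimage, hβ, Function.comp_apply, e.left_inv hz.2] at hzB
    exact hzB
  · rw [Filter.disjoint_iff]
    refine ⟨Dᶜ, hD.isOpen_compl.mem_nhds hm, β.source,
      Filter.mem_inf_of_right (Filter.mem_principal_self _), ?_⟩
    rw [hβs]
    exact disjoint_compl_left.mono_right Set.inter_subset_left

omit [ChartedSpace (EuclideanSpace ℝ (Fin n)) M] [IsManifold (𝓡 n) ∞ M] in
theorem EscapesAt.not_mapClusterPt {α : Chart n M} {p : EuclideanSpace ℝ (Fin n)}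
    (h : EscapesAt α p) {x : ℕ → M} (hx : ∀ i, x i ∈ α.source)
    (hp : Tendsto (fun i => α (x i)) atTop (𝓝 p)) (m : M) : ¬ MapClusterPt m atTop x := by
  intro hm
  refine hm.neBot.ne ?_
  refine ((h m).mono_right ?_).eq_bot
  exact le_inf (Filter.tendsto_iff_comap.1 (Filter.tendsto_map'_iff.2 hp))
    (Filter.le_principal_iff.2 (Filter.mem_map.2 (Filter.univ_mem' hx)))

omit [IsManifold (𝓡 n) ∞ M] in
theorem continuous_toCompletion (Q : Set (Chart n M × Set (EuclideanSpace ℝ (Fin n)))) :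
    Continuous (toCompletion Q) := continuous_quotient_mk'

/-- If the coordinates of the sequence accumulate at an escaping boundary point, the sequence
accumulates in the completion. -/
theorem exists_mapClusterPt_of_escapesAt {α : Chart n M}
    (hα : α ∈ IsManifold.maximalAtlas (𝓡 n) ∞ M) {U : Set (EuclideanSpace ℝ (Fin n))}
    (hU : IsOpen U) (hUα : ∀ p ∈ U, p ∉ α.target → EscapesAt α p)
    {p : EuclideanSpace ℝ (Fin n)} (hpU : p ∈ U) (hpα : p ∉ α.target) {x : ℕ → M}
    (hx : ∀ W ∈ 𝓝 p, ∃ᶠ i in atTop, x i ∈ α.source ∧ α (x i) ∈ W) :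
    ∃ q : Completion (maxExtensions n M),
      MapClusterPt q atTop (fun i => incl (maxExtensions n M) (x i)) := by
  have hpf : p ∈ frontier α.target := by
    rw [α.open_target.frontier_eq]
    refine ⟨mem_closure_iff_nhds.2 fun W hW => ?_, hpα⟩
    obtain ⟨i, hi, hiW⟩ := (hx W hW).exists
    exact ⟨_, hiW, α.map_source hi⟩
  have hext : IsExtension α (U ∪ α.target) := by
    have ho : IsOpen (U ∪ α.target) := hU.union α.open_target
    refine ⟨ho, Set.subset_union_right, ⟨p, ?_⟩, ?_⟩
    · rw [relBoundary_eq ho]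
      exact ⟨Or.inl hpU, hpf⟩
    · rw [relBoundary_eq ho]
      rintro q ⟨hq, hqf⟩
      have hqα : q ∉ α.target := by
        rw [α.open_target.frontier_eq] at hqf
        exact hqf.2
      exact ⟨hqf, fun y hy hyq m =>
        (hUα q (hq.resolve_right hqα) hqα).not_mapClusterPt hy hyq m⟩
  have hex : Extendible α := ⟨_, hext⟩
  let s : indexPairs (maxExtensions n M) := ⟨(α, maxExtension α), Or.inr ⟨hα, hex, rfl⟩⟩
  have hmax := (isGreatest_maxExtension hex).1
  have hps : p ∈ piece s.1 := by
    refine Or.inr ?_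
    change p ∈ relBoundary (maxExtension α) α.target
    rw [relBoundary_eq hmax.isOpen]
    exact ⟨(isGreatest_maxExtension hex).2 hext (Or.inl hpU), hpf⟩
  refine ⟨toCompletion _ ⟨s, ⟨p, hps⟩⟩, mapClusterPt_iff_frequently.2 fun N hN => ?_⟩
  have hc : Continuous fun z : piece s.1 => toCompletion (maxExtensions n M) ⟨s, z⟩ :=
    (continuous_toCompletion _).comp continuous_sigmaMk
  obtain ⟨W, hW, hWN⟩ := mem_nhds_subtype _ _ _ |>.1 (hc.continuousAt hN)
  refine (hx W hW).mono fun i hi => ?_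
  have h1 : toCompletion (maxExtensions n M) ⟨s, ⟨α (x i), Or.inl (α.map_source hi.1)⟩⟩ ∈ N :=
    hWN (show (⟨α (x i), Or.inl (α.map_source hi.1)⟩ : piece s.1) ∈ Subtype.val ⁻¹' W from hi.2)
  rw [← toCompletion_coordPoint _ α hα (x i) hi.1]
  convert h1 using 1
  -- The copies of `α (x i)` in the trivial piece and in the piece of the maximal extension are
  -- glued by the identity coordinate change.
  exact Quotient.sound (Or.inl ⟨α.map_source hi.1, α.map_source hi.1,
    α.map_target (α.map_source hi.1), α.right_inv (α.map_source hi.1)⟩)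

theorem exists_mapClusterPt_of_mapClusterPt {m : M} {x : ℕ → M} (hx : MapClusterPt m atTop x)
    (Q : Set (Chart n M × Set (EuclideanSpace ℝ (Fin n)))) :
    MapClusterPt (incl Q m) atTop (fun i => incl Q (x i)) := by
  have hcont : ContinuousAt (incl Q) m := by
    let e : Chart n M := chartAt (EuclideanSpace ℝ (Fin n)) m
    have he : e ∈ IsManifold.maximalAtlas (𝓡 n) ∞ M := IsManifold.chart_mem_maximalAtlas m
    have hm : m ∈ e.source := mem_chart_source _ m
    have h1 : ContinuousOn (incl Q) e.source := by
      rw [continuousOn_iff_continuous_domRestrict]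
      have h2 : Continuous fun z : e.source =>
          toCompletion Q (coordPoint Q e he z.1 z.2) := by
        refine (continuous_toCompletion Q).comp (continuous_sigmaMk.comp ?_)
        exact Continuous.subtype_mk (continuousOn_iff_continuous_domRestrict.1 e.continuousOn) _
      refine h2.congr fun z => ?_
      exact toCompletion_coordPoint Q e he z.1 z.2
    exact h1.continuousAt (e.open_source.mem_nhds hm)
  exact hx.continuousAt_comp hcont

end Charts

/-! ### Divergent sequences in one component; removing points from noncompact components -/

section Ends

variable {n : ℕ} {M : Type*} [TopologicalSpace M] [T2Space M]
  [ChartedSpace (EuclideanSpace ℝ (Fin n)) M] [IsManifold (𝓡 n) ∞ M]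

theorem tendsto_cocompact_of_forall_not_mapClusterPt {X : Type*} [TopologicalSpace X] {x : ℕ → X}
    (hx : ∀ m, ¬ MapClusterPt m atTop x) : Tendsto x atTop (cocompact X) := by
  refine (hasBasis_cocompact.tendsto_right_iff).2 fun K hK => ?_
  by_contra h
  obtain ⟨m, -, hm⟩ := hK.exists_mapClusterPt_of_frequently
    ((Filter.not_eventually.1 h).mono fun i hi => not_not.1 hi)
  exact hx m hm

/-- A divergent sequence returning infinitely often to one component accumulates in the
completion. -/
theorem exists_mapClusterPt_of_frequently_mem_component [SigmaCompactSpace M] {x : ℕ → M}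
    (hx : Tendsto x atTop (cocompact M)) {x₀ : M}
    (h₀ : ∃ᶠ i in atTop, x i ∈ connectedComponent x₀) :
    ∃ q : Completion (maxExtensions n M),
      MapClusterPt q atTop (fun i => incl (maxExtensions n M) (x i)) := by
  have : LocallyConnectedSpace M :=
    ChartedSpace.locallyConnectedSpace (EuclideanSpace ℝ (Fin n)) M
  have : LocallyCompactSpace M :=
    ChartedSpace.locallyCompactSpace (EuclideanSpace ℝ (Fin n)) M
  have : Nonempty M := ⟨x₀⟩
  have hne : NeBot (atTop ⊓ 𝓟 {i | x i ∈ connectedComponent x₀}) :=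
    Filter.frequently_mem_iff_neBot.1 h₀
  let 𝒱 : Ultrafilter ℕ := Ultrafilter.of (atTop ⊓ 𝓟 {i | x i ∈ connectedComponent x₀})
  have h𝒱 := Ultrafilter.of_le (atTop ⊓ 𝓟 {i | x i ∈ connectedComponent x₀})
  let 𝒰 : Ultrafilter M := 𝒱.map x
  have h𝒰 : (𝒰 : Filter M) ≤ cocompact M :=
    (Filter.map_mono (h𝒱.trans inf_le_left)).trans hx
  have h𝒰₀ : connectedComponent x₀ ∈ 𝒰 :=
    h𝒱 (Filter.mem_inf_of_right (Filter.mem_principal_self _))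
  obtain ⟨V, hV, hVo, hVc, hVK⟩ := exists_isPreconnected_mem_ultrafilter h𝒰 h𝒰₀ isCompact_empty
  obtain ⟨y, hy⟩ := 𝒰.nonempty_of_mem hV
  obtain ⟨C, hC, hCy⟩ := exists_compact_mem_nhds y
  -- Taking `S` to be the range of the sequence makes the chain of pushed points consist, after its
  -- start, of terms of the sequence.
  obtain ⟨f, hf, -, -, hinf⟩ := exists_isSelfEmbedding_notMem_range (n := n) h𝒰 h𝒰₀
    isCompact_empty hV hVo hVc hVK hy
    (S := Set.range x) (Filter.mem_map.2 (Filter.univ_mem' fun i => ⟨i, rfl⟩)) hCy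
  have hfreq : ∃ᶠ i in atTop, f (x i) ∈ C := by
    rw [Nat.frequently_atTop_iff_infinite]
    intro hfin
    refine hinf ((hfin.image x).subset ?_)
    rintro _ ⟨⟨i, rfl⟩, hi⟩
    exact ⟨i, hi, rfl⟩
  obtain ⟨z, -, hz⟩ := hC.exists_mapClusterPt_of_frequently hfreq
  -- If `z = f m`, then `f '' K` is a neighbourhood of `z` for a compact neighbourhood `K` of `m`,
  -- and injectivity would return infinitely many terms to `K`.
  have hzf : z ∉ Set.range f := by
    rintro ⟨m, rfl⟩
    obtain ⟨K, hK, hKm⟩ := exists_compact_mem_nhds m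
    have h1 : f '' K ∈ 𝓝 (f m) := by
      rw [← hf.map_nhds_eq]
      exact Filter.image_mem_map hKm
    obtain ⟨i, ⟨w, hw, hwi⟩, hi⟩ := ((mapClusterPt_iff_frequently.1 hz _ h1).and_eventually
      (hx hK.compl_mem_cocompact)).exists
    exact hi (hf.injective hwi ▸ hw)
  let e : Chart n M := chartAt (EuclideanSpace ℝ (Fin n)) z
  have he : e ∈ IsManifold.maximalAtlas (𝓡 n) ∞ M := IsManifold.chart_mem_maximalAtlas z
  have hze : z ∈ e.source := mem_chart_source _ z
  obtain ⟨β, hβ, hβs, hβe⟩ := hf.exists_chart he isOpen_univ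
  refine exists_mapClusterPt_of_escapesAt hβ e.open_target
    (fun p hp hpβ => hf.escapesAt isClosed_univ hβs hβe hp hpβ) (e.map_source hze) ?_
    fun W hW => ?_
  · intro hzβ
    have h1 := β.map_target hzβ
    rw [hβs] at h1
    refine hzf ⟨_, e.injOn h1.2 hze ?_⟩
    have h2 := β.right_inv hzβ
    rwa [hβe] at h2
  · refine (mapClusterPt_iff_frequently.1 hz _ (Filter.inter_mem (e.open_source.mem_nhds hze)
      (e.continuousAt hze hW))).mono fun i hi => ?_
    rw [hβs, hβe]
    exact ⟨⟨Set.mem_univ _, hi.1⟩, hi.2⟩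

/-- No point cuts a relatively compact piece off a noncompact component. -/
theorem not_subset_isCompact_connectedComponentIn_diff (n : ℕ) {M : Type*} [TopologicalSpace M]
    [T2Space M] [ChartedSpace (EuclideanSpace ℝ (Fin n)) M] [IsManifold (𝓡 n) ∞ M] {c q : M}
    (hc : ¬ IsCompact (connectedComponent c)) (hq : q ∈ connectedComponent c) (hqc : q ≠ c)
    {L : Set M} (hL : IsCompact L) :
    ¬ connectedComponentIn (connectedComponent c \ {c}) q ⊆ L := by
  intro hsub
  have : LocallyConnectedSpace M :=
    ChartedSpace.locallyConnectedSpace (EuclideanSpace ℝ (Fin n)) M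
  set M₀ := connectedComponent c with hM₀
  have hM₀o : IsOpen M₀ := isOpen_connectedComponent
  have hM₀c : IsPreconnected M₀ := isPreconnected_connectedComponent
  have hcM : c ∈ M₀ := mem_connectedComponent
  -- `P m A` says that `m` cuts off the relatively compact open piece `A` with connected remainder.
  -- Homogeneity spreads one such piece to every point of `M₀`; the pieces are then nested, and a
  -- minimal one is contradictory.
  let P (m : M) (A : Set M) : Prop := IsOpen A ∧ A ⊆ M₀ ∧ A.Nonempty ∧ m ∉ A ∧
    IsCompact (insert m A) ∧ IsPreconnected (M₀ \ A)
  have hbase : P c (connectedComponentIn (M₀ \ {c}) q) := by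
    set A := connectedComponentIn (M₀ \ {c}) q with hA
    have hcA : c ∉ A := fun h => (connectedComponentIn_subset _ _ h).2 rfl
    have hcl : closure A ⊆ insert c A := by
      intro z hz
      by_cases hzc : z = c
      · exact Or.inl hzc
      · refine Or.inr (closure_connectedComponentIn_inter_subset _ _ ⟨hz, ?_, hzc⟩)
        exact closure_minimal ((connectedComponentIn_subset _ _).trans Set.sdiff_subset)
          isClosed_connectedComponent hz
    refine ⟨(hM₀o.sdiff isClosed_singleton).connectedComponentIn,
      (connectedComponentIn_subset _ _).trans Set.sdiff_subset,
      ⟨q, mem_connectedComponentIn ⟨hq, hqc⟩⟩, hcA, ?_, ?_⟩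
    · have h1 : insert c A = insert c (closure A) :=
        Set.Subset.antisymm (Set.insert_subset_insert subset_closure)
          (Set.insert_subset (Set.mem_insert _ _) hcl)
      rw [h1]
      exact (hL.closure_of_subset hsub).insert c
    -- The remainder is the union of `{c}` and the other components of `M₀ \ {c}`, each of which
    -- accumulates at `c`.
    · refine isPreconnected_of_forall c fun z hz => ?_
      by_cases hzc : z = c
      · exact ⟨{c}, by simp [hcM, hcA], rfl, hzc, isPreconnected_singleton⟩
      · refine ⟨insert c (connectedComponentIn (M₀ \ {c}) z), Set.insert_subset ⟨hcM, hcA⟩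
          fun w hw => ⟨(connectedComponentIn_subset _ _ hw).1, fun hwA => hz.2 ?_⟩,
          Set.mem_insert _ _, Or.inr (mem_connectedComponentIn ⟨hz.1, hzc⟩),
          isPreconnected_insert_connectedComponentIn_diff hM₀o hM₀c hcM hz.1 hzc⟩
        rw [hA, connectedComponentIn_eq hwA, ← connectedComponentIn_eq hw]
        exact mem_connectedComponentIn ⟨hz.1, hzc⟩
  have hex : ∀ m : M₀, ∃ A, P m A := by
    rintro ⟨m, hm⟩
    obtain ⟨g, hg, hg'⟩ := exists_diffeomorph_move (n := n) hM₀o hM₀c hcM hm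
    have hgM : g '' M₀ = M₀ := by
      have hmem : ∀ z, g z ∈ M₀ ↔ z ∈ M₀ := fun z => by
        refine ⟨fun h => ?_, fun h => ?_⟩
        · by_contra hz
          exact hz (hg' z hz ▸ h)
        · by_contra hz
          have h1 : g z = z := g.injective (hg' _ hz)
          exact hz (h1.symm ▸ h)
      ext z
      refine ⟨fun ⟨w, hw, hwz⟩ => hwz ▸ (hmem w).2 hw, fun hz => ⟨g.symm z, ?_, ?_⟩⟩
      · rw [← hmem]
        simpa using hz
      · simp
    obtain ⟨h1, h2, h3, h4, h5, h6⟩ := hbase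
    set A := connectedComponentIn (M₀ \ {c}) q
    refine ⟨g '' A, g.toHomeomorph.isOpenMap _ h1, ?_, h3.image _, ?_, ?_, ?_⟩
    · exact (Set.image_mono h2).trans hgM.subset
    · rintro ⟨w, hw, hwm⟩
      exact h4 (g.injective (hwm.trans hg.symm) ▸ hw)
    · have := h5.image g.continuous
      rwa [Set.image_insert_eq, hg] at this
    · have := h6.image g g.continuous.continuousOn
      have hginj : Function.Injective (g : M → M) := g.injective
      rwa [Set.image_sdiff hginj, hgM] at this
  choose A hAo hAM hAn hmA hAc hAp using hex
  have key : ∀ m m' : M₀, m'.1 ∈ A m → insert m'.1 (A m') ⊆ A m := by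
    intro m m' hm'
    refine Set.insert_subset hm' ?_
    -- The connected set `M₀ \ A m` avoids `m'`, so if it met `A m'` it would lie inside it, and
    -- `M₀` would be covered by two compact sets.
    have hd : Disjoint (M₀ \ A m) (A m') := by
      by_contra hnd
      obtain ⟨z, hz, hz'⟩ := Set.not_disjoint_iff.1 hnd
      have h1 : M₀ \ A m ⊆ A m' := by
        refine (hAp m).subset_left_of_subset_union (hAo m') (hAc m').isClosed.isOpen_compl
          (disjoint_compl_right.mono_left (Set.subset_insert _ _)) (fun w hw => ?_) ⟨z, hz, hz'⟩
        by_cases hwA : w ∈ A m'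
        · exact Or.inl hwA
        · refine Or.inr ?_
          rintro (h | h)
          · exact hw.2 (h ▸ hm')
          · exact hwA h
      refine hc (((hAc m).union (hAc m')).of_isClosed_subset isClosed_connectedComponent ?_)
      intro w hw
      by_cases hwA : w ∈ A m
      · exact Or.inl (Or.inr hwA)
      · exact Or.inr (Or.inr (h1 ⟨hw, hwA⟩))
    intro w hw
    by_contra hwA
    exact Set.disjoint_left.1 hd ⟨hAM m' hw, hwA⟩ hw
  let r (a b : M₀) : Prop := b.1 ∈ insert a.1 (A a)
  have hr : ∀ a b, r a b → insert b.1 (A b) ⊆ insert a.1 (A a) := by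
    rintro a b (h | h)
    · rw [Subtype.ext h]
    · exact (key a b h).trans (Set.subset_insert _ _)
  -- Zorn's lemma for reverse inclusion: a chain of compact sets `insert a (A a)` has a common
  -- point, and that point bounds the chain.
  obtain ⟨m, hm⟩ := exists_maximal_of_chains_bounded (r := r) (fun S hS => by
    rcases S.eq_empty_or_nonempty with rfl | hSn
    · exact ⟨⟨c, hcM⟩, by simp⟩
    have : Nonempty S := hSn.to_subtype
    obtain ⟨z, hz⟩ := IsCompact.nonempty_iInter_of_directed_nonempty_isCompact_isClosed
      (fun a : S => insert a.1.1 (A a.1)) (fun a b => by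
        by_cases hab : a = b
        · exact ⟨a, subset_rfl, hab ▸ subset_rfl⟩
        · rcases hS a.2 b.2 (fun h => hab (Subtype.ext h)) with h | h
          · exact ⟨b, hr _ _ h, subset_rfl⟩
          · exact ⟨a, subset_rfl, hr _ _ h⟩)
      (fun a => ⟨_, Set.mem_insert _ _⟩) (fun a => hAc _) (fun a => (hAc _).isClosed)
    rw [Set.mem_iInter] at hz
    obtain ⟨a, ha⟩ := hSn
    have hzM : z ∈ M₀ := Set.insert_subset a.2 (hAM a) (hz ⟨a, ha⟩)
    exact ⟨⟨z, hzM⟩, fun b hb => hz ⟨b, hb⟩⟩) (fun {a b c} hab hbc => hr a b hab hbc)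
  -- A point `w` of the minimal piece gives `insert w (A w) ⊆ A m`, and minimality puts `m` in the
  -- left side, against `m ∉ A m`.
  obtain ⟨w, hw⟩ := hAn m
  exact hmA m (key m ⟨w, hAM m hw⟩ hw (hm ⟨w, hAM m hw⟩ (Or.inr hw)))

/-- Pushing a point of a noncompact component to infinity, leaving another point fixed. -/
theorem exists_isSelfEmbedding_fix_of_ne [SigmaCompactSpace M] {c q : M}
    (hc : ¬ IsCompact (connectedComponent c)) (hq : q ∈ connectedComponent c) (hqc : q ≠ c) :
    ∃ f : M → M, IsSelfEmbedding n f ∧ q ∉ Set.range f ∧ f c = c := by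
  have : LocallyConnectedSpace M :=
    ChartedSpace.locallyConnectedSpace (EuclideanSpace ℝ (Fin n)) M
  set V := connectedComponentIn (connectedComponent c \ {c}) q with hV
  -- The component of `q` after removing `c` is not relatively compact, so `q` can be pushed to
  -- infinity inside it while the compact set `{c}` stays fixed.
  have hne : NeBot (cocompact M ⊓ 𝓟 V) := by
    rw [Filter.inf_principal_neBot_iff]
    intro t ht
    obtain ⟨L, hL, hLt⟩ := mem_cocompact.1 ht
    obtain ⟨z, hz, hzL⟩ := Set.not_subset.1
      (not_subset_isCompact_connectedComponentIn_diff n hc hq hqc hL)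
    exact ⟨z, hLt hzL, hz⟩
  have h𝒰 := Ultrafilter.of_le (cocompact M ⊓ 𝓟 V)
  have hV𝒰 : V ∈ Ultrafilter.of (cocompact M ⊓ 𝓟 V) :=
    h𝒰 (Filter.mem_inf_of_right (Filter.mem_principal_self _))
  obtain ⟨f, hf, hqf, hfc, -⟩ := exists_isSelfEmbedding_notMem_range (n := n)
    (h𝒰.trans inf_le_left) (x₀ := c) (Filter.mem_of_superset hV𝒰
      ((connectedComponentIn_subset _ _).trans Set.sdiff_subset))
    (isCompact_singleton (x := c)) hV𝒰
    ((isOpen_connectedComponent.sdiff isClosed_singleton).connectedComponentIn)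
    isPreconnected_connectedComponentIn
    (Set.disjoint_singleton_right.2 fun h => (connectedComponentIn_subset _ _ h).2 rfl)
    (mem_connectedComponentIn ⟨hq, hqc⟩) Filter.univ_mem Filter.univ_mem
  exact ⟨f, hf, hqf, hfc c rfl⟩

/-- Two points of a noncompact component can be removed by an embedding fixing a third one. -/
theorem exists_isSelfEmbedding_fix_of_ne_of_ne [SigmaCompactSpace M] {c q₁ q₂ : M}
    (hc : ¬ IsCompact (connectedComponent c)) (hq₁ : q₁ ∈ connectedComponent c) (hq₁c : q₁ ≠ c)
    (hq₂c : q₂ ≠ c) :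
    ∃ f : M → M, IsSelfEmbedding n f ∧ f c = c ∧
      ∀ z ∈ connectedComponent c, f z ≠ q₁ ∧ f z ≠ q₂ := by
  obtain ⟨f, hf, hqf, hfc⟩ := exists_isSelfEmbedding_fix_of_ne (n := n) hc hq₁ hq₁c
  -- If `q₂` is still attained from the component, a second push applied beforehand removes its
  -- preimage `w`.
  by_cases h : ∃ w ∈ connectedComponent c, f w = q₂
  · obtain ⟨w, hw, rfl⟩ := h
    have hwc : w ≠ c := fun h => hq₂c (by rw [h, hfc])
    obtain ⟨k, hk, hwk, hkc⟩ := exists_isSelfEmbedding_fix_of_ne (n := n) hc hw hwc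
    exact ⟨f ∘ k, hf.comp hk, by simp [hkc, hfc], fun z _ => ⟨fun h => hqf ⟨_, h⟩,
      fun h => hwk ⟨_, hf.injective h⟩⟩⟩
  · exact ⟨f, hf, hfc, fun z hz => ⟨fun h' => hqf ⟨_, h'⟩, fun h' => h ⟨z, hz, h'⟩⟩⟩

end Ends

/-! ### Opening two points into the faces of a slab -/

section Slab

variable {E : Type*} [NormedAddCommGroup E] [InnerProductSpace ℝ E]

/-- The slab coordinate rescaled so that `l` and `u` go to `-1` and `1`. -/
noncomputable def slabHeight (v : E) (l u : ℝ) (x : E) : ℝ := (2 * inner ℝ v x - (l + u)) / (u - l)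

/-- The map collapsing the two faces of the slab `l ≤ ⟪v, x⟫ ≤ u` to the points `-v` and `v`. -/
noncomputable def slabCollapse (v : E) (l u : ℝ) (x : E) : E :=
  slabHeight v l u x • v + (1 - slabHeight v l u x ^ 2) • (x - inner ℝ v x • v)

/-- The inverse of `slabCollapse` over the points between `-v` and `v`. -/
noncomputable def slabExpand (v : E) (l u : ℝ) (x : E) : E :=
  ((l + u + (u - l) * inner ℝ v x) / 2) • v +
    (1 - (inner ℝ v x : ℝ) ^ 2)⁻¹ • (x - (inner ℝ v x : ℝ) • v)

theorem contDiff_inner_left (v : E) : ContDiff ℝ ∞ (fun x : E => (inner ℝ v x : ℝ)) :=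
  contDiff_const.inner ℝ contDiff_id

theorem contDiff_slabHeight (v : E) (l u : ℝ) : ContDiff ℝ ∞ (slabHeight v l u) := by
  have := contDiff_inner_left v
  unfold slabHeight
  fun_prop

theorem contDiff_slabCollapse (v : E) (l u : ℝ) : ContDiff ℝ ∞ (slabCollapse v l u) := by
  have := contDiff_inner_left v
  have := contDiff_slabHeight v l u
  unfold slabCollapse
  fun_prop

theorem contDiffOn_slabExpand (v : E) (l u : ℝ) :
    ContDiffOn ℝ ∞ (slabExpand v l u) {x | |(inner ℝ v x : ℝ)| < 1} := by
  have h0 := (contDiff_inner_left v).contDiffOn (s := {x | |(inner ℝ v x : ℝ)| < 1})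
  unfold slabExpand
  have h1 : ContDiffOn ℝ ∞ (fun x : E => (1 - (inner ℝ v x : ℝ) ^ 2)⁻¹)
      {x | |(inner ℝ v x : ℝ)| < 1} := by
    refine ContDiffOn.inv (by fun_prop) fun x hx => ?_
    have := (sq_lt_one_iff_abs_lt_one (inner ℝ v x : ℝ)).2 hx
    exact (sub_pos.2 this).ne'
  exact ContDiffOn.add (by fun_prop) (h1.smul (by fun_prop))

variable {v : E} (hv : ‖v‖ = 1)

include hv

theorem inner_sub_inner_smul (x : E) : inner ℝ v (x - (inner ℝ v x : ℝ) • v) = (0 : ℝ) := by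
  rw [inner_sub_right, inner_smul_right, real_inner_self_eq_norm_sq, hv]
  ring

theorem inner_smul_add_smul (s c : ℝ) (x : E) :
    inner ℝ v (s • v + c • (x - (inner ℝ v x : ℝ) • v)) = s := by
  rw [inner_add_right, inner_smul_right, inner_smul_right, inner_sub_inner_smul hv,
    real_inner_self_eq_norm_sq, hv]
  ring

theorem inner_slabCollapse (l u : ℝ) (x : E) :
    inner ℝ v (slabCollapse v l u x) = slabHeight v l u x := inner_smul_add_smul hv _ _ _

theorem inner_slabExpand (l u : ℝ) (x : E) :
    inner ℝ v (slabExpand v l u x) = (l + u + (u - l) * inner ℝ v x) / 2 :=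
  inner_smul_add_smul hv _ _ _

theorem slabHeight_slabExpand {l u : ℝ} (h : l < u) (x : E) :
    slabHeight v l u (slabExpand v l u x) = inner ℝ v x := by
  have : u - l ≠ 0 := (sub_pos.2 h).ne'
  rw [slabHeight, inner_slabExpand hv]
  field_simp
  ring

theorem slabCollapse_slabExpand {l u : ℝ} (h : l < u) {x : E} (hx : |(inner ℝ v x : ℝ)| < 1) :
    slabCollapse v l u (slabExpand v l u x) = x := by
  have h1 : (1 - (inner ℝ v x : ℝ) ^ 2) ≠ 0 :=
    (sub_pos.2 ((sq_lt_one_iff_abs_lt_one _).2 hx)).ne'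
  rw [slabCollapse, slabHeight_slabExpand hv h, inner_slabExpand hv, slabExpand,
    add_sub_cancel_left, smul_smul, mul_inv_cancel₀ h1, one_smul, add_sub_cancel]

theorem slabExpand_slabCollapse {l u : ℝ} (h : l < u) {x : E} (hx : |slabHeight v l u x| < 1) :
    slabExpand v l u (slabCollapse v l u x) = x := by
  have h1 : (1 - slabHeight v l u x ^ 2) ≠ 0 :=
    (sub_pos.2 ((sq_lt_one_iff_abs_lt_one _).2 hx)).ne'
  have h2 : (l + u + (u - l) * slabHeight v l u x) / 2 = inner ℝ v x := by
    have : u - l ≠ 0 := (sub_pos.2 h).ne'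
    rw [slabHeight]
    field_simp
    ring
  rw [slabExpand, inner_slabCollapse hv, h2, slabCollapse, add_sub_cancel_left, smul_smul,
    inv_mul_cancel₀ h1, one_smul, add_sub_cancel]

omit hv in
theorem abs_slabHeight_lt_one_iff {l u : ℝ} (h : l < u) (x : E) :
    |slabHeight v l u x| < 1 ↔ l < inner ℝ v x ∧ (inner ℝ v x : ℝ) < u := by
  have : 0 < u - l := sub_pos.2 h
  rw [slabHeight, abs_lt, lt_div_iff₀ this, div_lt_iff₀ this]
  constructor <;> rintro ⟨h1, h2⟩ <;> constructor <;> linarith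

/-- A diffeomorphism of a spindle between `-v` and `v` onto a solid cylinder in the slab
`l < ⟪v, x⟫ < u`. -/
noncomputable def slabChart {l u : ℝ} (h : l < u) : OpenPartialHomeomorph E E where
  toFun := slabExpand v l u
  invFun := slabCollapse v l u
  source := {x | |(inner ℝ v x : ℝ)| < 1 ∧
    ‖x - (inner ℝ v x : ℝ) • v‖ < 1 - (inner ℝ v x : ℝ) ^ 2}
  target := {x | |slabHeight v l u x| < 1 ∧ ‖x - (inner ℝ v x : ℝ) • v‖ < 1}
  map_source' x hx := by
    have h1 := sub_pos.2 ((sq_lt_one_iff_abs_lt_one _).2 hx.1)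
    refine ⟨by rw [slabHeight_slabExpand hv h]; exact hx.1, ?_⟩
    rw [inner_slabExpand hv, slabExpand, add_sub_cancel_left, norm_smul, norm_inv,
      Real.norm_of_nonneg h1.le, inv_mul_lt_iff₀ h1, mul_one]
    exact hx.2
  map_target' x hx := by
    have h1 := sub_pos.2 ((sq_lt_one_iff_abs_lt_one _).2 hx.1)
    refine ⟨by rw [inner_slabCollapse hv]; exact hx.1, ?_⟩
    rw [inner_slabCollapse hv, slabCollapse, add_sub_cancel_left, norm_smul,
      Real.norm_of_nonneg h1.le]
    exact mul_lt_of_lt_one_right h1 hx.2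
  left_inv' x hx := slabCollapse_slabExpand hv h hx.1
  right_inv' x hx := slabExpand_slabCollapse hv h hx.1
  open_source := by
    have h1 := (contDiff_inner_left v).continuous
    have h2 : Continuous fun x : E => |(inner ℝ v x : ℝ)| := by fun_prop
    have h3 : Continuous fun x : E => ‖x - (inner ℝ v x : ℝ) • v‖ := by fun_prop
    have h4 : Continuous fun x : E => 1 - (inner ℝ v x : ℝ) ^ 2 := by fun_prop
    exact (isOpen_lt h2 continuous_const).inter (isOpen_lt h3 h4)
  open_target := by
    have h1 := (contDiff_inner_left v).continuous
    have h2 : Continuous fun x : E => |slabHeight v l u x| :=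
      (contDiff_slabHeight v l u).continuous.abs
    have h3 : Continuous fun x : E => ‖x - (inner ℝ v x : ℝ) • v‖ := by fun_prop
    exact (isOpen_lt h2 continuous_const).inter (isOpen_lt h3 continuous_const)
  continuousOn_toFun := (contDiffOn_slabExpand v l u).continuousOn.mono fun x hx => hx.1
  continuousOn_invFun := (contDiff_slabCollapse v l u).continuous.continuousOn

end Slab

/-! ### Charts on disjoint unions -/

section Union

variable {n : ℕ} {M : Type*} [TopologicalSpace M]
  [ChartedSpace (EuclideanSpace ℝ (Fin n)) M] [IsManifold (𝓡 n) ∞ M]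

/-- The disjoint union of charts with disjoint sources and disjoint targets. -/
theorem exists_chart_iUnion [Nonempty M] {ι : Type*} {φ : ι → Chart n M}
    (hφ : ∀ i, φ i ∈ IsManifold.maximalAtlas (𝓡 n) ∞ M)
    (hs : ∀ i j, i ≠ j → Disjoint (φ i).source (φ j).source)
    (ht : ∀ i j, i ≠ j → Disjoint (φ i).target (φ j).target) :
    ∃ α ∈ IsManifold.maximalAtlas (𝓡 n) ∞ M, α.source = ⋃ i, (φ i).source ∧
      ∀ i, ∀ x ∈ (φ i).source, α x = φ i x := by
  classical
  let a : M → EuclideanSpace ℝ (Fin n) := fun x =>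
    if h : ∃ i, x ∈ (φ i).source then φ h.choose x else 0
  have ha : ∀ i, ∀ x ∈ (φ i).source, a x = φ i x := by
    intro i x hx
    have h : ∃ i, x ∈ (φ i).source := ⟨i, hx⟩
    have h1 : h.choose = i := by
      by_contra hne
      exact Set.disjoint_left.1 (hs _ _ hne) h.choose_spec hx
    change (if h : ∃ i, x ∈ (φ i).source then φ h.choose x else 0) = φ i x
    rw [dif_pos h, h1]
  obtain ⟨α, hα, hαs, hαa⟩ := exists_chart_of_locally_eq (n := n) (a := a)
    (isOpen_iUnion fun i => (φ i).open_source) (fun x hx y hy hxy => by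
      obtain ⟨i, hi⟩ := Set.mem_iUnion.1 hx
      obtain ⟨j, hj⟩ := Set.mem_iUnion.1 hy
      rw [ha i x hi, ha j y hj] at hxy
      by_cases hij : i = j
      · subst hij
        exact (φ i).injOn hi hj hxy
      · exact (Set.disjoint_left.1 (ht i j hij) ((φ i).map_source hi)
          (hxy ▸ (φ j).map_source hj)).elim) fun x hx => by
      obtain ⟨i, hi⟩ := Set.mem_iUnion.1 hx
      exact ⟨φ i, hφ i, hi, Filter.eventuallyEq_of_mem ((φ i).open_source.mem_nhds hi) (ha i)⟩
  exact ⟨α, hα, hαs, fun i x hx => by rw [hαa, ha i x hx]⟩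

end Union

/-! ### Sequences running through infinitely many components -/

section Final

variable {n : ℕ} {M : Type*} [TopologicalSpace M] [T2Space M]
  [ChartedSpace (EuclideanSpace ℝ (Fin n)) M] [IsManifold (𝓡 n) ∞ M]

omit [T2Space M] in
/-- Every point is the origin of a chart whose range contains a large ball with preimage in a given
neighbourhood of the point. -/
theorem exists_chart_ball (x : M) {O : Set M} (hO : O ∈ 𝓝 x) :
    ∃ e ∈ IsManifold.maximalAtlas (𝓡 n) ∞ M, x ∈ e.source ∧ e x = 0 ∧
      ∀ p ∈ Metric.ball 0 3, p ∈ e.target ∧ e.symm p ∈ O := by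
  let e₀ : Chart n M := chartAt (EuclideanSpace ℝ (Fin n)) x
  have he₀ : e₀ ∈ IsManifold.maximalAtlas (𝓡 n) ∞ M := IsManifold.chart_mem_maximalAtlas x
  have hx : x ∈ e₀.source := mem_chart_source _ x
  have hW : e₀.target ∩ e₀.symm ⁻¹' O ∈ 𝓝 (e₀ x) := by
    refine Filter.inter_mem (e₀.open_target.mem_nhds (e₀.map_source hx))
      (e₀.continuousAt_symm (e₀.map_source hx) ?_)
    rwa [e₀.left_inv hx]
  obtain ⟨r, hr, hrW⟩ := Metric.mem_nhds_iff.1 hW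
  have hr3 : 3 / r ≠ 0 := by positivity
  let h : EuclideanSpace ℝ (Fin n) ≃ₜ EuclideanSpace ℝ (Fin n) :=
    (Homeomorph.subRight (e₀ x)).trans (Homeomorph.smulOfNeZero (3 / r) hr3)
  have hh : ∀ p, h p = (3 / r) • (p - e₀ x) := fun p => rfl
  have hh' : ∀ p, h.symm p = (3 / r)⁻¹ • p + e₀ x := fun p => rfl
  refine ⟨e₀ ≫ₕ h.toOpenPartialHomeomorph, trans_mem_maximalAtlas he₀ _ ?_ ?_, ⟨hx, trivial⟩,
    ?_, fun p hp => ?_⟩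
  · have : ContDiff ℝ ∞ fun p => (3 / r) • (p - e₀ x) := by fun_prop
    exact this.contDiffOn
  · have : ContDiff ℝ ∞ fun p => (3 / r)⁻¹ • p + e₀ x := by fun_prop
    exact this.contDiffOn
  · change h (e₀ x) = 0
    rw [hh, sub_self, smul_zero]
  · have h1 : h.symm p ∈ Metric.ball (e₀ x) r := by
      rw [hh', mem_ball_iff_norm, add_sub_cancel_right, norm_smul, norm_inv,
        Real.norm_of_nonneg (by positivity), inv_mul_lt_iff₀ (by positivity),
        div_mul_cancel₀ _ hr.ne']
      simpa using hp
    exact ⟨⟨trivial, (hrW h1).1⟩, (hrW h1).2⟩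

/-- A chart of a noncompact component centred at a given point, defined up to escaping points of the
ball of radius `3`, and missing `v` and `-v`. -/
theorem exists_chart_of_not_isCompact_component [SigmaCompactSpace M] {x : M}
    (hx : ¬ IsCompact (connectedComponent x)) {v : EuclideanSpace ℝ (Fin n)} (hv : ‖v‖ = 1) :
    ∃ β ∈ IsManifold.maximalAtlas (𝓡 n) ∞ M, β.source ⊆ connectedComponent x ∧
      x ∈ β.source ∧ β x = 0 ∧ v ∉ β.target ∧ -v ∉ β.target ∧
      ∀ p ∈ Metric.ball 0 3, p ∉ β.target → EscapesAt β p := by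
  have : LocallyConnectedSpace M :=
    ChartedSpace.locallyConnectedSpace (EuclideanSpace ℝ (Fin n)) M
  have : Nonempty M := ⟨x⟩
  obtain ⟨e, he, hxe, hex, hball⟩ := exists_chart_ball (n := n) x
    (isOpen_connectedComponent.mem_nhds (mem_connectedComponent (x := x)))
  have hv0 : v ≠ 0 := norm_ne_zero_iff.1 (by rw [hv]; exact one_ne_zero)
  have hv₁ : v ∈ Metric.ball (0 : EuclideanSpace ℝ (Fin n)) 3 := by simp [hv]
  have hv₂ : -v ∈ Metric.ball (0 : EuclideanSpace ℝ (Fin n)) 3 := by simp [hv]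
  have hne : ∀ p ∈ Metric.ball (0 : EuclideanSpace ℝ (Fin n)) 3, p ≠ 0 → e.symm p ≠ x := by
    intro p hp hp0 h
    rw [← e.right_inv (hball p hp).1, h, hex] at hp0
    exact hp0 rfl
  -- The embedding fixes the centre `x` and omits, on its component, the points with coordinates `v`
  -- and `-v`; its pulled back chart inherits both properties.
  obtain ⟨f, hf, hfx, hfv⟩ := exists_isSelfEmbedding_fix_of_ne_of_ne (n := n) hx
    (hball v hv₁).2 (hne v hv₁ hv0) (hne (-v) hv₂ (neg_ne_zero.2 hv0))
  obtain ⟨β, hβ, hβs, hβe⟩ := hf.exists_chart he (isOpen_connectedComponent (x := x))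
  have hmiss : ∀ p ∈ β.target, ∃ z ∈ connectedComponent x, f z = e.symm p := by
    intro p hp
    have h1 := β.map_target hp
    rw [hβs] at h1
    refine ⟨_, h1.1, ?_⟩
    have h2 := β.right_inv hp
    rw [hβe] at h2
    conv_rhs => rw [← h2]
    exact (e.left_inv h1.2).symm
  refine ⟨β, hβ, hβs ▸ Set.inter_subset_left, ?_, ?_, fun h => ?_, fun h => ?_,
    fun p hp hpβ => hf.escapesAt isClosed_connectedComponent hβs hβe (hball p hp).1 hpβ⟩
  · rw [hβs]
    exact ⟨mem_connectedComponent, by rwa [Set.mem_preimage, hfx]⟩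
  · rw [hβe, Function.comp_apply, hfx, hex]
  · obtain ⟨z, hz, hfz⟩ := hmiss _ h
    exact (hfv z hz).1 hfz
  · obtain ⟨z, hz, hfz⟩ := hmiss _ h
    exact (hfv z hz).2 hfz

-- In filter form, escape can be tested on a single component and transported through a change of
-- coordinates.
omit [T2Space M] [ChartedSpace (EuclideanSpace ℝ (Fin n)) M] [IsManifold (𝓡 n) ∞ M] in
theorem escapesAt_of_forall_filter {α : Chart n M} {p : EuclideanSpace ℝ (Fin n)}
    (h : ∀ (m : M) (G : Filter M), G.NeBot → G ≤ 𝓝 m → Tendsto α G (𝓝 p) → α.source ∈ G → False) :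
    EscapesAt α p := by
  intro m
  rw [disjoint_iff]
  by_contra hne
  exact h m _ ⟨hne⟩ inf_le_left
    (Filter.tendsto_iff_comap.2 (inf_le_right.trans inf_le_left))
    (Filter.mem_inf_of_right (Filter.mem_inf_of_right (Filter.mem_principal_self _)))

omit [T2Space M] [ChartedSpace (EuclideanSpace ℝ (Fin n)) M] [IsManifold (𝓡 n) ∞ M] in
theorem EscapesAt.not_neBot {α : Chart n M} {p : EuclideanSpace ℝ (Fin n)} (h : EscapesAt α p)
    {m : M} {G : Filter M} (hG : G.NeBot) (hm : G ≤ 𝓝 m) (hp : Tendsto α G (𝓝 p))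
    (hs : α.source ∈ G) : False :=
  hG.ne (bot_unique ((h m).le_bot.trans' (le_inf hm
    (le_inf (Filter.tendsto_iff_comap.1 hp) (Filter.le_principal_iff.2 hs)))))

/-- Infinitely many terms of the sequence in different noncompact components. -/
theorem exists_mapClusterPt_of_infinite_components [SigmaCompactSpace M] {x : ℕ → M} {J : Set ℕ}
    (hJ : ∃ᶠ i in atTop, i ∈ J) (hJc : ∀ i ∈ J, ¬ IsCompact (connectedComponent (x i)))
    (hJd : ∀ i ∈ J, ∀ j ∈ J, i ≠ j → Disjoint (connectedComponent (x i)) (connectedComponent (x j)))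
    {v : EuclideanSpace ℝ (Fin n)} (hv : ‖v‖ = 1) :
    ∃ q : Completion (maxExtensions n M),
      MapClusterPt q atTop (fun i => incl (maxExtensions n M) (x i)) := by
  have : LocallyConnectedSpace M :=
    ChartedSpace.locallyConnectedSpace (EuclideanSpace ℝ (Fin n)) M
  have : Nonempty M := ⟨x 0⟩
  choose β hβ hβs hxβ hβx hvβ hvβ' hβesc using fun i : J =>
    exists_chart_of_not_isCompact_component (n := n) (hJc i.1 i.2) hv
  -- The slabs between `l (i + 1)` and `l i` are disjoint and shrink to the hyperplane through `0`.
  let l : ℕ → ℝ := fun i => 1 / ((i : ℝ) + 1)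
  have hl0 : ∀ i, 0 < l i := fun i => Nat.one_div_pos_of_nat
  have hlanti : StrictAnti l := fun i j hij => Nat.one_div_lt_one_div hij
  have hl : ∀ i, l (i + 1) < l i := fun i => hlanti (Nat.lt_succ_self i)
  let τ : ℕ → OpenPartialHomeomorph (EuclideanSpace ℝ (Fin n)) (EuclideanSpace ℝ (Fin n)) :=
    fun i => slabChart hv (hl i)
  have hτt : ∀ i, ∀ p, p ∈ (τ i).target ↔
      (l (i + 1) < inner ℝ v p ∧ (inner ℝ v p : ℝ) < l i) ∧
        ‖p - (inner ℝ v p : ℝ) • v‖ < 1 := fun i p =>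
    and_congr_left' (abs_slabHeight_lt_one_iff (hl i) p)
  let φ : J → Chart n M := fun i => β i ≫ₕ τ i
  have hφ : ∀ i, φ i ∈ IsManifold.maximalAtlas (𝓡 n) ∞ M := fun i =>
    trans_mem_maximalAtlas (hβ i) _ ((contDiffOn_slabExpand v _ _).mono fun p hp => hp.1)
      (contDiff_slabCollapse v _ _).contDiffOn
  have hφs : ∀ i, (φ i).source ⊆ connectedComponent (x i) := fun i z hz => hβs i hz.1
  obtain ⟨α, hα, hαs, hαφ⟩ := exists_chart_iUnion hφ
    (fun i j hij => (hJd i i.2 j j.2 fun h => hij (Subtype.ext h)).mono (hφs i) (hφs j))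
    (fun i j hij => by
      refine Set.disjoint_left.2 fun p hp hp' => ?_
      have h1 := ((hτt i p).1 hp.1).1
      have h2 := ((hτt j p).1 hp'.1).1
      rcases lt_or_gt_of_ne fun h => hij (Subtype.ext h) with h | h
      · have : l j ≤ l (i + 1) := hlanti.antitone h
        linarith [h1.1, h2.2]
      · have : l i ≤ l (j + 1) := hlanti.antitone h
        linarith [h2.1, h1.2])
  have hinner := (contDiff_inner_left v).continuous
  have hdist : Continuous fun p => ‖p - (inner ℝ v p : ℝ) • v‖ := by fun_prop
  have hx0 : ∀ i : J, τ i 0 = ((l i + l (i + 1)) / 2) • v ∧ x i ∈ (φ i).source := by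
    intro i
    refine ⟨?_, hxβ i, ?_⟩
    · change slabExpand v (l (i + 1)) (l i) 0 = _
      simp [slabExpand, add_comm]
    · change β i (x i) ∈ (τ i).source
      rw [hβx]
      change |(inner ℝ v (0 : EuclideanSpace ℝ (Fin n)) : ℝ)| < 1 ∧ _
      simp
  have hαx : ∀ i : J, α (x i) = ((l i + l (i + 1)) / 2) • v := by
    intro i
    rw [hαφ i _ (hx0 i).2, ← (hx0 i).1, ← hβx i]
    rfl
  -- `U` is the full open cylinder around the axis `v`, containing `0`, the faces of all slabs and
  -- the half with nonpositive height.
  refine exists_mapClusterPt_of_escapesAt hα (p := 0)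
    (U := {p | ‖p - (inner ℝ v p : ℝ) • v‖ < 1}) (isOpen_lt hdist continuous_const)
    (fun p hp hpα => ?_) (by simp) (fun h => ?_) fun W hW => ?_
  · refine escapesAt_of_forall_filter fun m G hG hGm hGp hGs => ?_
    have hGc : connectedComponent m ∈ G :=
      hGm (isOpen_connectedComponent.mem_nhds mem_connectedComponent)
    -- The sources lie in distinct components, so near `m` only one of them is met.
    obtain ⟨i, hi⟩ : ∃ i : J, (φ i).source ∈ G := by
      obtain ⟨z, hzs, hzm⟩ := hG.nonempty_of_mem (Filter.inter_mem hGs hGc)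
      rw [hαs] at hzs
      obtain ⟨i, hi⟩ := Set.mem_iUnion.1 hzs
      refine ⟨i, Filter.mem_of_superset (Filter.inter_mem hGs hGc) ?_⟩
      rintro w ⟨hws, hwm⟩
      rw [hαs] at hws
      obtain ⟨j, hj⟩ := Set.mem_iUnion.1 hws
      have h1 : connectedComponent (x i) = connectedComponent (x j) :=
        (connectedComponent_eq (hφs i hi)).trans
          ((connectedComponent_eq hzm).symm.trans ((connectedComponent_eq hwm).trans
            (connectedComponent_eq (hφs j hj)).symm))
      have hij : i = j := by
        by_contra hne
        have h2 := hJd i i.2 j j.2 fun h => hne (Subtype.ext h)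
        rw [h1] at h2
        exact Set.disjoint_left.1 h2 mem_connectedComponent mem_connectedComponent
      exact hij ▸ hj
    have hGα : ∀ᶠ z in G, z ∈ (β i).source ∧ β i z = (τ i).symm (α z) ∧ α z ∈ (τ i).target := by
      filter_upwards [hi] with z hz
      have h1 : α z = τ i (β i z) := hαφ i z hz
      exact ⟨hz.1, by rw [h1]; exact ((τ i).left_inv hz.2).symm,
        by rw [h1]; exact (τ i).map_source hz.2⟩
    have hlim := (hinner.tendsto p).comp hGp
    have hlp : l (i + 1) ≤ inner ℝ v p :=
      ge_of_tendsto hlim (hGα.mono fun z hz => ((hτt i _).1 hz.2.2).1.1.le)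
    have hpl : (inner ℝ v p : ℝ) ≤ l i :=
      le_of_tendsto hlim (hGα.mono fun z hz => ((hτt i _).1 hz.2.2).1.2.le)
    -- Collapsing the slab is continuous on the whole space, so the `β i` coordinates converge even
    -- when `p` lies on a face.
    have hβlim : Tendsto (β i) G (𝓝 (slabCollapse v (l (i + 1)) (l i) p)) :=
      (((contDiff_slabCollapse v _ _).continuous.tendsto p).comp hGp).congr'
        (hGα.mono fun z hz => hz.2.1.symm)
    refine (hβesc i _ ?_ ?_).not_neBot hG hGm hβlim (hGα.mono fun z hz => hz.1)
    · have hs : |slabHeight v (l (i + 1)) (l i) p| ≤ 1 := by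
        have := sub_pos.2 (hl i)
        rw [slabHeight, abs_le, le_div_iff₀ this, div_le_iff₀ this]
        constructor <;> linarith
      have hs2 := (sq_le_one_iff_abs_le_one _).2 hs
      rw [mem_ball_zero_iff]
      -- The collapse of the closed slab within the cylinder has norm at most 2, inside the ball of
      -- radius 3 where missing points of `β i` escape.
      calc ‖slabCollapse v (l (i + 1)) (l i) p‖
          ≤ |slabHeight v (l (i + 1)) (l i) p| * ‖v‖ +
            (1 - slabHeight v (l (i + 1)) (l i) p ^ 2) * ‖p - (inner ℝ v p : ℝ) • v‖ := by
            refine (norm_add_le _ _).trans_eq ?_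
            rw [norm_smul, norm_smul, Real.norm_eq_abs, Real.norm_of_nonneg (sub_nonneg.2 hs2)]
        _ ≤ 1 * 1 + 1 * 1 := by
            rw [hv]
            have h1 : ‖p - (inner ℝ v p : ℝ) • v‖ ≤ 1 := le_of_lt hp
            gcongr
            linarith [sq_nonneg (slabHeight v (l (i + 1)) (l i) p)]
        _ < 3 := by norm_num
    · intro hpt
      -- On the faces the collapse is `-v` or `v`, which `β i` omits; strictly between them, `p`
      -- would already belong to `α.target`.
      have hd : l i - l (i + 1) ≠ 0 := (sub_pos.2 (hl i)).ne'
      rcases hlp.eq_or_lt with h | h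
      · refine hvβ' i ?_
        have : slabHeight v (l (i + 1)) (l i) p = -1 := by
          rw [slabHeight, ← h]; field_simp; ring
        simpa [slabCollapse, this] using hpt
      rcases hpl.eq_or_lt with h' | h'
      · refine hvβ i ?_
        have : slabHeight v (l (i + 1)) (l i) p = 1 := by
          rw [slabHeight, h']; field_simp; ring
        simpa [slabCollapse, this] using hpt
      have hpφ : p ∈ (φ i).target := ⟨(hτt i p).2 ⟨⟨h, h'⟩, hp⟩, hpt⟩
      refine hpα ?_
      have h1 := (φ i).map_target hpφ
      rw [← (φ i).right_inv hpφ, ← hαφ i _ h1]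
      exact α.map_source (hαs ▸ Set.mem_iUnion.2 ⟨i, h1⟩)
  · have h1 := α.map_target h
    rw [hαs] at h1
    obtain ⟨i, hi⟩ := Set.mem_iUnion.1 h1
    have h2 : φ i (α.symm 0) = 0 := by rw [← hαφ i _ hi, α.right_inv h]
    have h3 := ((hτt i _).1 ((φ i).map_source hi).1).1.1
    rw [h2, inner_zero_right] at h3
    exact (hl0 _).not_gt h3
  · have hlim : Tendsto (fun i : ℕ => ((l i + l (i + 1)) / 2) • v) atTop (𝓝 0) := by
      have h1 : Tendsto l atTop (𝓝 0) := tendsto_one_div_add_atTop_nhds_zero_nat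
      have h2 := ((h1.add (h1.comp (tendsto_add_atTop_nat 1))).div_const 2).smul_const v
      simpa using h2
    refine (hJ.and_eventually (hlim hW)).mono fun i hi => ?_
    refine ⟨hαs ▸ Set.mem_iUnion.2 ⟨⟨i, hi.1⟩, (hx0 ⟨i, hi.1⟩).2⟩, ?_⟩
    rw [hαx ⟨i, hi.1⟩]
    exact hi.2

/-- In dimension zero chart domains are single points, so components are points. Positive dimension
is what supplies the unit vector `v`. -/
theorem ne_zero_of_not_isCompact_component (n : ℕ) {M : Type*} [TopologicalSpace M] [T1Space M]
    [ChartedSpace (EuclideanSpace ℝ (Fin n)) M] {x : M}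
    (hx : ¬ IsCompact (connectedComponent x)) : n ≠ 0 := by
  rintro rfl
  refine hx ?_
  let e : Chart 0 M := chartAt (EuclideanSpace ℝ (Fin 0)) x
  have hxe : x ∈ e.source := mem_chart_source _ x
  have h1 : e.source = {x} := Set.eq_singleton_iff_unique_mem.2
    ⟨hxe, fun y hy => e.injOn hy hxe (Subsingleton.elim _ _)⟩
  have h2 : IsClopen ({x} : Set M) := ⟨isClosed_singleton, h1 ▸ e.open_source⟩
  have h3 : connectedComponent x = {x} :=
    Set.Subset.antisymm (h2.connectedComponent_subset rfl)
      (Set.singleton_subset_iff.2 mem_connectedComponent)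
  rw [h3]
  exact isCompact_singleton

/-- A sequence leaving every component visits infinitely many noncompact components. -/
theorem exists_frequently_mem_disjoint_components {X : Type*} [TopologicalSpace X]
    (hcomp : {C : Set X | (∃ x : X, C = connectedComponent x) ∧ IsCompact C}.Finite) {x : ℕ → X}
    (hx : ∀ y, ∀ᶠ i in atTop, x i ∉ connectedComponent y) :
    ∃ J : Set ℕ, (∃ᶠ i in atTop, i ∈ J) ∧ (∀ i ∈ J, ¬ IsCompact (connectedComponent (x i))) ∧
      ∀ i ∈ J, ∀ j ∈ J, i ≠ j → Disjoint (connectedComponent (x i)) (connectedComponent (x j)) := by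
  classical
  -- `J` consists of the times of first visit to noncompact components.
  refine ⟨{j | ¬ IsCompact (connectedComponent (x j)) ∧
    ∀ i < j, connectedComponent (x i) ≠ connectedComponent (x j)}, ?_, fun i hi => hi.1, ?_⟩
  · have hnc : ∀ᶠ i in atTop, ¬ IsCompact (connectedComponent (x i)) := by
      have h1 : ∀ᶠ i in atTop, ∀ C ∈ {C : Set X | (∃ x : X, C = connectedComponent x) ∧
          IsCompact C}, x i ∉ C := by
        rw [Filter.eventually_all_finite hcomp]
        rintro C ⟨⟨y, rfl⟩, -⟩
        exact hx y
      exact h1.mono fun i hi hc => hi _ ⟨⟨_, rfl⟩, hc⟩ mem_connectedComponent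
    refine Filter.frequently_atTop.2 fun N => ?_
    have hN : ∀ᶠ i in atTop, ∀ k ∈ Set.Iic N, x i ∉ connectedComponent (x k) :=
      (Filter.eventually_all_finite (Set.finite_Iic N)).2 fun k _ => hx (x k)
    -- The component of `x i` contains none of the terms up to `N`, so its first visit occurs after
    -- `N`.
    obtain ⟨i, hic, hiN⟩ := (hnc.and hN).exists
    have hex : ∃ j, connectedComponent (x j) = connectedComponent (x i) := ⟨i, rfl⟩
    have hj := Nat.find_spec hex
    refine ⟨Nat.find hex, ?_, ?_, fun k hk h => Nat.find_min hex hk (h.trans hj)⟩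
    · by_contra h
      exact hiN _ (not_le.1 h).le (by rw [hj]; exact mem_connectedComponent)
    · rwa [hj]
  · intro i hi j hj hij
    refine connectedComponent_disjoint ?_
    rcases lt_or_gt_of_ne hij with h | h
    · exact hj.2 i h
    · exact (hi.2 j h).symm

end Final

end ChartBoundary


/-! ### Assembly of the three cases -/

theorem mainTheorem5 (n : ℕ) (M : Type*) [TopologicalSpace M] [T2Space M]
    [SecondCountableTopology M] [ChartedSpace (EuclideanSpace ℝ (Fin n)) M]
    [IsManifold (𝓡 n) ∞ M]
    (hcomp : {C : Set M | (∃ x : M, C = connectedComponent x) ∧ IsCompact C}.Finite)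
    (x : ℕ → M) :
    ∃ p : ChartBoundary.Completion (ChartBoundary.maxExtensions n M),
      MapClusterPt p atTop
        (fun i => ChartBoundary.incl (ChartBoundary.maxExtensions n M) (x i)) := by
  -- Together with second countability this makes `M` σ-compact, which the exhaustions require.
  have : LocallyCompactSpace M :=
    ChartedSpace.locallyCompactSpace (EuclideanSpace ℝ (Fin n)) M
  by_cases hm : ∃ m, MapClusterPt m atTop x
  · obtain ⟨m, hm⟩ := hm
    exact ⟨_, ChartBoundary.exists_mapClusterPt_of_mapClusterPt hm _⟩
  by_cases h₀ : ∃ x₀, ∃ᶠ i in atTop, x i ∈ connectedComponent x₀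
  · obtain ⟨x₀, h₀⟩ := h₀
    exact ChartBoundary.exists_mapClusterPt_of_frequently_mem_component
      (ChartBoundary.tendsto_cocompact_of_forall_not_mapClusterPt (not_exists.1 hm)) h₀
  · obtain ⟨J, hJ, hJc, hJd⟩ := ChartBoundary.exists_frequently_mem_disjoint_components hcomp
      fun y => Filter.not_frequently.1 fun h => h₀ ⟨y, h⟩
    obtain ⟨j, hj⟩ := hJ.exists
    have : NeZero n := ⟨ChartBoundary.ne_zero_of_not_isCompact_component n (hJc j hj)⟩
    exact ChartBoundary.exists_mapClusterPt_of_infinite_components hJ hJc hJd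
      (v := EuclideanSpace.single 0 1) (by simp)
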